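/- Conventions. Variables are named by binary words. A clause is a finite set of literals, read as a disjunction; a CNF formula is a finite set of clauses, read as a conjunction; $\bot$ is the CNF formula consisting of the empty clause. $\mathrm{CNF}$ is the class of all CNF formulas, and $\mathrm{ID}$ is the class of the CNF formulas in which every clause contains at most one literal and that literal is positive (so every clause is a positive unit clause $\{x\}$ or the empty clause). For a set $S$ of CNF formulas, $\mathrm{Th}(S)$ is the set of CNF formulas entailed by $S$. A default theory $\langle W,D\rangle$ consists of a finite set $W$ of CNF formulas and a finite set $D$ of default rules $\frac{\alpha:\beta}{\gamma}$ with CNF formulas $\alpha,\beta,\gamma$; it is a $\Theta$-default theory if all these formulas lie in the class $\Theta$. For a set $E$ of CNF formulas, $\Gamma(E)$ is the smallest set with $W\subseteq\Gamma(E)$, $\Gamma(E)=\mathrm{Th}(\Gamma(E))$, and $\gamma\in\Gamma(E)$ for every $\frac{\alpha:\beta}{\gamma}\in D$ with $\alpha\in\Gamma(E)$ and $\neg\beta\notin E$ (where $\neg\beta\in E$ means that $E$ contains a CNF formula equivalent to $\neg\beta$). $E$ is a stable extension if $E=\Gamma(E)$, and it is consistent if $\bot\notin E$. For a literal $\ell$,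 the reduct $\varphi[\ell]$ of a CNF formula $\varphi$ arises by deleting all clauses that contain $\ell$ and deleting the literal complementary to $\ell$ from the remaining clauses. For a symbol $x_\varepsilon$ ($x$ a variable), $\varphi[x_\varepsilon]$ arises by deleting $x$ and $\neg x$ from all clauses. For a finite set $B$ of variables, a threefold assignment set over $B$ contains exactly one of $x,\neg x,x_\varepsilon$ for each $x\in B$ and nothing else, and $\varphi[Y]$ is the result of the consecutive reducts by the elements of such a set $Y$. The reduct of $\langle W,D\rangle$ by $Y$ has the knowledge base $\bigcup_{\omega\in W}\omega[Y]$ and, for every $\delta=\frac{\alpha:\beta}{\gamma}\in D$, the rule $\frac{\alpha[Y]:\beta[Y]}{\gamma[Y]\wedge y_\delta}$ with a fresh variable $y_\delta$. A set $B$ of variables of $\langle W,D\rangle$ is a strong $\Theta'$-backdoor of $\langle W,D\rangle$ if for every threefold assignment set $Y$ over $B$ the reduct of $\langle W,D\rangle$ by $Y$ is a $\Theta'$-default theory. $\mathrm{SBD}_{\mathrm{expl}}(\Theta\to\Theta')$ is the following parameterised problem. Input: a $\Theta$-default theory $\langle W,D\rangle$ and a strong $\Theta'$-backdoor $B$ of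 it, written explicitly as a word over a fixed finite alphabet. Parameter: $|B|$. Question: does $\langle W,D\rangle$ have a stable extension? (Words that do not encode such an instance with the given parameter value are no-instances.) A parameterised problem $L\subseteq\Sigma^*\times\mathbb N$ is in $\mathrm{FPT}$ if there are a finite alphabet $\Sigma'$, a computable function $f:\mathbb N\to\Sigma'^*$ and a problem $L'\subseteq\Sigma^*\times\Sigma'^*$ that is decidable in polynomial time by a Turing machine, such that $(x,k)\in L\iff(x,f(k))\in L'$ for all $x,k$. Corollary. $\mathrm{SBD}_{\mathrm{expl}}(\mathrm{CNF}\to\mathrm{ID})\in\mathrm{FPT}$. The same holds for the variant of the problem that asks for a consistent stable extension. -/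

import Mathlib

namespace DefaultLogic

/-! ### Clauses, CNF formulas, consequence -/

/-- A literal over the variables `V`. -/
inductive Literal (V : Type) where
  | pos (x : V)
  | neg (x : V)
  deriving DecidableEq

namespace Literal

variable {V U : Type}

/-- The variable of a literal. -/
def var : Literal V → V
  | pos x => x
  | neg x => x

/-- The complementary literal. -/
def compl : Literal V → Literal V
  | pos x => neg x
  | neg x => pos x

/-- Renaming of variables. -/
def map (f : V → U) : Literal V → Literal U
  | pos x => pos (f x)
  | neg x => neg (f x)

/-- The literal `l` is true under the truth assignment `v`. -/
def Holds (v : V → Bool) : Literal V → Prop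
  | pos x => v x = true
  | neg x => v x = false

end Literal

/-- A clause is a finite set of literals, read as their disjunction. -/
abbrev Clause (V : Type) := Finset (Literal V)

/-- A CNF formula is a finite set of clauses, read as their conjunction. -/
abbrev CNF (V : Type) := Finset (Clause V)

section

variable {V U : Type} [DecidableEq V] [DecidableEq U]

/-- The truth assignment `v` satisfies `φ`. -/
def CNF.Sat (v : V → Bool) (φ : CNF V) : Prop :=
  ∀ C ∈ φ, ∃ l ∈ C, Literal.Holds v l

/-- The formula `⊥`, consisting of the empty clause only. -/
def CNF.bot : CNF V := {∅}

/-- The variables of a formula. -/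
def CNF.vars (φ : CNF V) : Finset V :=
  φ.biUnion fun C => C.image Literal.var

/-- Renaming of variables. -/
def CNF.rename (f : V → U) (φ : CNF V) : CNF U :=
  φ.image fun C => C.image (Literal.map f)

/-- `S ⊨ ψ` for a (possibly infinite) set `S` of formulas. -/
def Entails (S : Set (CNF V)) (ψ : CNF V) : Prop :=
  ∀ v : V → Bool, (∀ φ ∈ S, CNF.Sat v φ) → CNF.Sat v ψ

/-- The deductive closure `Th(S)`, within the CNF formulas. -/
def Th (S : Set (CNF V)) : Set (CNF V) := {ψ | Entails S ψ}

/-- `ψ` is a CNF formula expressing `¬β`. -/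
def IsNegationOf (ψ β : CNF V) : Prop :=
  ∀ v : V → Bool, CNF.Sat v ψ ↔ ¬ CNF.Sat v β

/-- `¬β ∈ E`: since the negation of a CNF formula is a CNF formula only up to equivalence, this
says that some CNF formula expressing `¬β` belongs to `E`. -/
def NegMem (β : CNF V) (E : Set (CNF V)) : Prop :=
  ∃ ψ ∈ E, IsNegationOf ψ β

end

/-! ### Default theories and stable extensions -/

/-- The default rule `prereq : just / concl`. -/
structure Default (V : Type) where
  prereq : CNF V
  just : CNF V
  concl : CNF V
  deriving DecidableEq

/-- A (finite) default theory `⟨W, D⟩`. -/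
structure DefaultTheory (V : Type) where
  W : Finset (CNF V)
  D : Finset (Default V)

/-- The variables of a default rule. -/
def Default.vars {V : Type} [DecidableEq V] (δ : Default V) : Finset V :=
  δ.prereq.vars ∪ δ.just.vars ∪ δ.concl.vars

namespace DefaultTheory

/-- The variables of a default theory. -/
def vars {V : Type} [DecidableEq V] (T : DefaultTheory V) : Finset V :=
  T.W.biUnion CNF.vars ∪ T.D.biUnion Default.vars

variable {V : Type}

/-- The three conditions on `S` in the definition of `Γ(E)`. -/
structure GammaClosed (T : DefaultTheory V) (E S : Set (CNF V)) : Prop where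
  base : ∀ φ ∈ T.W, φ ∈ S
  closed : S = Th S
  rules : ∀ δ ∈ T.D, δ.prereq ∈ S → ¬ NegMem δ.just E → δ.concl ∈ S

/-- `Γ(E)`, the smallest set satisfying the three conditions. -/
def Gamma (T : DefaultTheory V) (E : Set (CNF V)) : Set (CNF V) :=
  ⋂₀ {S | T.GammaClosed E S}

/-- `Γ(E)` satisfies the three conditions, hence it is the smallest set that does. -/
theorem gamma_isLeast (T : DefaultTheory V) (E : Set (CNF V)) :
    IsLeast {S | T.GammaClosed E S} (T.Gamma E) := by
  refine ⟨⟨?_, ?_, ?_⟩, fun S hS => Set.sInter_subset_of_mem hS⟩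
  · intro φ hφ S hS
    exact hS.base φ hφ
  · apply Set.Subset.antisymm
    · intro ψ hψ v hv
      exact hv ψ hψ
    · intro ψ hψ S hS
      rw [hS.closed]
      intro v hv
      exact hψ v fun φ hφ => hv φ (hφ S hS)
  · intro δ hδ hp hj S hS
    exact hS.rules δ hδ (hp S hS) hj

/-- `E` is a stable extension of `T`. -/
def IsStableExtension (T : DefaultTheory V) (E : Set (CNF V)) : Prop :=
  E = T.Gamma E

/-- `T` has a stable extension. -/
def HasStableExtension (T : DefaultTheory V) : Prop :=
  ∃ E, T.IsStableExtension E

/-- `T` has a consistent stable extension, that is, one that does not contain `⊥`. -/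
def HasConsistentStableExtension (T : DefaultTheory V) : Prop :=
  ∃ E, T.IsStableExtension E ∧ CNF.bot ∉ E

end DefaultTheory

/-! ### Classes of formulas -/

/-- A class of CNF formulas (over any set of variables). -/
abbrev FormulaClass := ∀ V : Type, Set (CNF V)

/-- The class of all CNF formulas. -/
def classCNF : FormulaClass := fun _ => Set.univ

/-- The class ID: every clause contains at most one literal, and that literal is positive. So the
clauses are the positive unit clauses `{x}` and the empty clause; the latter arises when reducts
delete literals and has to be allowed for the class to be closed under subformulas. -/
def classID : FormulaClass := fun _ => {φ | ∀ C ∈ φ, C = ∅ ∨ ∃ x, C = {Literal.pos x}}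

/-- `T` is a `Θ`-default theory. -/
def DefaultTheory.InClass {V : Type} (Θ : FormulaClass) (T : DefaultTheory V) : Prop :=
  (∀ φ ∈ T.W, φ ∈ Θ V) ∧
    ∀ δ ∈ T.D, δ.prereq ∈ Θ V ∧ δ.just ∈ Θ V ∧ δ.concl ∈ Θ V

/-! ### Reducts and strong backdoors -/

/-- Extended literals: a literal, or `x_ε` for a variable `x`. -/
inductive ExtLiteral (V : Type) where
  | lit (l : Literal V)
  | eps (x : V)

/-- The variable of an extended literal. -/
def ExtLiteral.var {V : Type} : ExtLiteral V → V
  | lit l => l.var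
  | eps x => x

section

variable {V : Type} [DecidableEq V]

/-- The reduct of `φ` by one extended literal. -/
def CNF.reduct (φ : CNF V) : ExtLiteral V → CNF V
  | .lit l => (φ.filter fun C => l ∉ C).image fun C => C.erase l.compl
  | .eps x => φ.image fun C => (C.erase (Literal.pos x)).erase (Literal.neg x)

/-- Consecutive application of the reducts by the extended literals in `Y`. -/
def CNF.reducts (φ : CNF V) (Y : List (ExtLiteral V)) : CNF V :=
  Y.foldl CNF.reduct φ

/-- `Y` lists (in some order) a threefold assignment set over `B`: it contains exactly one of
`x`, `¬x`, `x_ε` for each `x ∈ B`, and nothing else. -/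
def IsThreefoldAssignment (B : Finset V) (Y : List (ExtLiteral V)) : Prop :=
  (Y.map ExtLiteral.var).Nodup ∧ (Y.map ExtLiteral.var).toFinset = B

/-- The reduct of a default theory. The fresh variable `y_δ` attached to the rule `δ` is
`Sum.inr δ`; the old variables `x` become `Sum.inl x`. -/
def DefaultTheory.reducts (T : DefaultTheory V) (Y : List (ExtLiteral V)) :
    DefaultTheory (V ⊕ Default V) where
  W := {CNF.rename Sum.inl (T.W.biUnion fun ω => CNF.reducts ω Y)}
  D := T.D.image fun δ =>
    { prereq := CNF.rename Sum.inl (CNF.reducts δ.prereq Y)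
      just := CNF.rename Sum.inl (CNF.reducts δ.just Y)
      concl := CNF.rename Sum.inl (CNF.reducts δ.concl Y) ∪ {{Literal.pos (Sum.inr δ)}} }

/-- `B` is a strong `Θ`-backdoor of `T`. -/
def DefaultTheory.IsStrongBackdoor (Θ : FormulaClass) (T : DefaultTheory V) (B : Finset V) :
    Prop :=
  B ⊆ T.vars ∧ ∀ Y, IsThreefoldAssignment B Y → (T.reducts Y).InClass Θ

end

/-! ### Inputs as words -/

/-- Variables are named by binary words. -/
abbrev Var := List Bool

/-- The finite input alphabet. -/
inductive Symb where
  | bit (b : Bool)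
  | pos
  | neg
  | endVar
  | endClause
  | endFormula
  | endPart
  deriving DecidableEq, Fintype

/-- Words for lists: the words of the entries one after the other, closed by the terminator `t`. -/
def encodeListWith {α : Type} (t : Symb) (c : α → List Symb) (l : List α) : List Symb :=
  l.flatMap c ++ [t]

/-- Word of a variable. -/
def encodeVar : Var → List Symb := encodeListWith .endVar fun b => [Symb.bit b]

/-- Word of a literal. -/
def encodeLiteral : Literal Var → List Symb
  | .pos x => Symb.pos :: encodeVar x
  | .neg x => Symb.neg :: encodeVar x

/-- Clauses and formulas as they are written in the input. -/
abbrev RawCNF := List (List (Literal Var))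

/-- Word of a formula. -/
def encodeCNF : RawCNF → List Symb :=
  encodeListWith .endFormula (encodeListWith .endClause encodeLiteral)

/-- Word of a default rule. -/
def encodeDefault (d : RawCNF × RawCNF × RawCNF) : List Symb :=
  encodeCNF d.1 ++ encodeCNF d.2.1 ++ encodeCNF d.2.2

/-- The formula that is written as `r`. -/
def RawCNF.toCNF (r : RawCNF) : CNF Var :=
  (r.map List.toFinset).toFinset

/-- An instance, as written in the input: a default theory together with a set of variables. -/
structure RawInstance where
  kb : List RawCNF
  rules : List (RawCNF × RawCNF × RawCNF)
  backdoor : List Var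

namespace RawInstance

/-- The input word. -/
def encode (I : RawInstance) : List Symb :=
  encodeListWith .endPart encodeCNF I.kb ++
    (encodeListWith .endPart encodeDefault I.rules ++
      encodeListWith .endPart encodeVar I.backdoor)

/-- The default theory of the instance. -/
def theory (I : RawInstance) : DefaultTheory Var where
  W := (I.kb.map RawCNF.toCNF).toFinset
  D := (I.rules.map fun d =>
    { prereq := RawCNF.toCNF d.1, just := RawCNF.toCNF d.2.1,
      concl := RawCNF.toCNF d.2.2 : Default Var }).toFinset

/-- The set of variables given with the instance. -/
def backdoorSet (I : RawInstance) : Finset Var := I.backdoor.toFinset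

end RawInstance

/-! The input words determine the instance. -/

theorem encodeListWith_inj {α : Type} {t : Symb} {c : α → List Symb}
    (hhead : ∀ a, ∃ s w, c a = s :: w ∧ s ≠ t)
    (hc : ∀ a b r s, c a ++ r = c b ++ s → a = b ∧ r = s) :
    ∀ (l m : List α) (r s : List Symb),
      encodeListWith t c l ++ r = encodeListWith t c m ++ s → l = m ∧ r = s := by
  intro l
  induction l with
  | nil =>
    intro m r s h
    cases m with
    | nil => simpa [encodeListWith] using h
    | cons b m =>
      obtain ⟨x, w, hx, hne⟩ := hhead b
      simp [encodeListWith, hx] at h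
      exact absurd h.1.symm hne
  | cons a l ih =>
    intro m r s h
    cases m with
    | nil =>
      obtain ⟨x, w, hx, hne⟩ := hhead a
      simp [encodeListWith, hx] at h
      exact absurd h.1 hne
    | cons b m =>
      have h' : c a ++ (encodeListWith t c l ++ r) = c b ++ (encodeListWith t c m ++ s) := by
        simpa [encodeListWith] using h
      obtain ⟨rfl, h2⟩ := hc _ _ _ _ h'
      obtain ⟨rfl, rfl⟩ := ih m r s h2
      exact ⟨rfl, rfl⟩

theorem encodeListWith_head {α : Type} {t u : Symb} {c : α → List Symb} (htu : t ≠ u)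
    (hhead : ∀ a, ∃ s w, c a = s :: w ∧ s ≠ u) (l : List α) :
    ∃ s w, encodeListWith t c l = s :: w ∧ s ≠ u := by
  cases l with
  | nil => exact ⟨t, [], by simp [encodeListWith], htu⟩
  | cons a l =>
    obtain ⟨x, w, hx, hne⟩ := hhead a
    exact ⟨x, w ++ encodeListWith t c l, by simp [encodeListWith, hx], hne⟩

theorem encodeVar_inj : ∀ (x y : Var) (r s : List Symb),
    encodeVar x ++ r = encodeVar y ++ s → x = y ∧ r = s :=
  encodeListWith_inj (fun _ => ⟨_, [], rfl, by simp⟩) (by simp)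

theorem encodeLiteral_inj (l m : Literal Var) (r s : List Symb)
    (h : encodeLiteral l ++ r = encodeLiteral m ++ s) : l = m ∧ r = s := by
  cases l <;> cases m <;> simp [encodeLiteral] at h
  all_goals
    obtain ⟨rfl, rfl⟩ := encodeVar_inj _ _ _ _ h
    exact ⟨rfl, rfl⟩

theorem encodeLiteral_head {u : Symb} (h1 : Symb.pos ≠ u) (h2 : Symb.neg ≠ u) (l : Literal Var) :
    ∃ s w, encodeLiteral l = s :: w ∧ s ≠ u := by
  cases l
  · exact ⟨_, _, rfl, h1⟩
  · exact ⟨_, _, rfl, h2⟩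

theorem encodeCNF_inj : ∀ (φ ψ : RawCNF) (r s : List Symb),
    encodeCNF φ ++ r = encodeCNF ψ ++ s → φ = ψ ∧ r = s :=
  encodeListWith_inj
    (encodeListWith_head (by simp) (encodeLiteral_head (by simp) (by simp)))
    (encodeListWith_inj (encodeLiteral_head (by simp) (by simp)) encodeLiteral_inj)

theorem encodeCNF_head : ∀ φ : RawCNF, ∃ s w, encodeCNF φ = s :: w ∧ s ≠ .endPart :=
  encodeListWith_head (by simp)
    (encodeListWith_head (by simp) (encodeLiteral_head (by simp) (by simp)))

theorem RawInstance.encode_injective : Function.Injective RawInstance.encode := by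
  rintro ⟨k₁, d₁, b₁⟩ ⟨k₂, d₂, b₂⟩ h
  obtain ⟨rfl, h⟩ := encodeListWith_inj encodeCNF_head encodeCNF_inj _ _ _ _ h
  have hd := encodeListWith_inj (t := .endPart) (c := encodeDefault)
    (fun d => by
      obtain ⟨s, w, hs, hne⟩ := encodeCNF_head d.1
      exact ⟨s, w ++ encodeCNF d.2.1 ++ encodeCNF d.2.2, by simp [encodeDefault, hs], hne⟩)
    (fun a b r s h => by
      obtain ⟨a1, a2, a3⟩ := a
      obtain ⟨b1, b2, b3⟩ := b
      simp only [encodeDefault, List.append_assoc] at h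
      obtain ⟨h1, h⟩ := encodeCNF_inj _ _ _ _ h
      obtain ⟨h2, h⟩ := encodeCNF_inj _ _ _ _ h
      obtain ⟨h3, h⟩ := encodeCNF_inj _ _ _ _ h
      exact ⟨by rw [h1, h2, h3], h⟩)
  obtain ⟨rfl, h⟩ := hd _ _ _ _ h
  have hb := encodeListWith_inj (t := .endPart) (c := encodeVar)
    (encodeListWith_head (by simp) (fun _ => ⟨_, [], rfl, by simp⟩)) encodeVar_inj
  obtain ⟨rfl, -⟩ := hb b₁ b₂ [] [] (by simpa using h)
  rfl

/-! ### Complexity classes -/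

/-- A parameterised problem over the alphabet `A`. -/
abbrev ParamProblem (A : Type) := Set (List A × ℕ)

open Classical in
/-- The problem `S` is in P, with instances written by the encoding `e`: some (multi-stack) Turing
machine decides `S` within a number of steps polynomial in the length of the input word. -/
def InP {α A : Type} [Fintype A] (e : Computability.Encoding α A) (S : Set α) : Prop :=
  Nonempty (Turing.TM2ComputableInPolyTime e.encode Computability.encodeBool
    fun a => decide (a ∈ S))

/-- FPT = para-P: there are a finite alphabet `Fin m`, a computable `f : ℕ → (Fin m)*` and a
problem `L' ⊆ A* × (Fin m)*` in P such that `(x, k) ∈ L ↔ (x, f k) ∈ L'`. -/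
def InFPT {A : Type} [Fintype A] (L : ParamProblem A) : Prop :=
  ∃ (m : ℕ) (f : ℕ → List (Fin m)) (L' : Set (List A × List (Fin m))),
    Computable f ∧
      InP (Computability.encodingProd (Computability.encodingList A)
        (Computability.encodingList (Fin m))) L' ∧
      ∀ x k, (x, k) ∈ L ↔ (x, f k) ∈ L'

/-! ### Strong backdoor evaluation -/

/-- Instances: a `Θ`-default theory with a strong `Θ'`-backdoor `B`; parameter: `|B|`; question:
does the theory have the property `Q`? -/
def backdoorEvaluation (Q : DefaultTheory Var → Prop) (Θ Θ' : FormulaClass) :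
    ParamProblem Symb :=
  {p | ∃ I : RawInstance, I.encode = p.1 ∧ I.theory.InClass Θ ∧
    I.theory.IsStrongBackdoor Θ' I.backdoorSet ∧ I.backdoorSet.card = p.2 ∧ Q I.theory}

/-- Strong backdoor evaluation for the existence of a stable extension. -/
def SBDexpl (Θ Θ' : FormulaClass) : ParamProblem Symb :=
  backdoorEvaluation DefaultTheory.HasStableExtension Θ Θ'

/-- Strong backdoor evaluation for the existence of a consistent stable extension. -/
def consistentSBDexpl (Θ Θ' : FormulaClass) : ParamProblem Symb :=
  backdoorEvaluation DefaultTheory.HasConsistentStableExtension Θ Θ'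

end DefaultLogic

/-!
Fix a set `B` of variables outside of which every clause is a single positive literal. For each
assignment of `B`, a formula over the remaining variables is then a conjunction of variables and
possibly `⊥`. If it has a model at all, it is satisfied by the all-true assignment, and it has a
least model. Hence entailment can be decided by looking at two assignments for each of the
`2 ^ |B|` assignments of `B`, and a formula is consistent with a set of such formulas iff they have
a common model among the all-true extensions.

Whether the justification of a rule is consistent with an extension `E` therefore only depends on
the set `A` of the assignments of `B` that are consistent with `E`. We guess `A`, apply the rules as
long as possible, with justifications read off from `A`, and accept if the result is consistent with
exactly the assignments in `A`. The stable extensions correspond to the accepted guesses, and the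
consistent ones to the nonempty guesses. As there are `2 ^ 2 ^ |B|` guesses, it suffices that
the computable function in the definition of FPT supplies a word of that length: what is done for
each guess is polynomial.

For the polynomial time, inputs and intermediate results are represented by binary trees. Functions
on trees that run in polynomial time on a multi-stack machine are closed under composition,
pairing, case distinction, and iteration along a list as long as the intermediate results remain of
polynomial size.
-/

/-! ### Structured programs over finitely many stacks -/

namespace StackProgram

open Function (update)

/-- Structured programs acting on stacks `k : K` with alphabets `Γ k` and a register in `σ`. They
compose more easily than the goto-programs `Turing.TM2.Stmt`, into which `Prog.code` translates
them. -/
inductive Prog {K : Type*} (Γ : K → Type*) (σ : Type*)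
  | push (k : K) (f : σ → Γ k)
  | pop (k : K) (f : σ → Option (Γ k) → σ)
  | load (f : σ → σ)
  | seq (p q : Prog Γ σ)
  | ite (c : σ → Bool) (p q : Prog Γ σ)
  | loop (c : σ → Bool) (p : Prog Γ σ)

namespace Prog

variable {K : Type*} {Γ : K → Type*} {σ Λ : Type*}

/-- The control points of a program. -/
def Label : Prog Γ σ → Type
  | push _ _ | pop _ _ | load _ => Unit
  | seq p q => Label p ⊕ Label q
  | ite _ p q => Option (Label p ⊕ Label q)
  | loop _ p => Option (Label p)

/-- There are finitely many control points, as a Turing machine requires of its labels. -/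
instance instFintypeLabel : ∀ p : Prog Γ σ, Fintype p.Label
  | push _ _ | pop _ _ | load _ => inferInstanceAs (Fintype Unit)
  | seq p q => @instFintypeSum _ _ (instFintypeLabel p) (instFintypeLabel q)
  | ite _ p q =>
    @instFintypeOption _ (@instFintypeSum _ _ (instFintypeLabel p) (instFintypeLabel q))
  | loop _ p => @instFintypeOption _ (instFintypeLabel p)

/-- The control point at which a program starts. -/
def entry : ∀ p : Prog Γ σ, p.Label
  | push _ _ | pop _ _ | load _ => ()
  | seq p _ => .inl (entry p)
  | ite _ _ _ => none
  | loop _ _ => none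

/-- The Turing machine code of a program whose control points are embedded by `emb` into the
labels of the machine, and which continues at the label `exit`. -/
def code : ∀ (p : Prog Γ σ) (_ : p.Label → Λ) (_ : Λ), p.Label → Turing.TM2.Stmt Γ Λ σ
  | push k f, _, exit => fun _ => .push k f (.goto fun _ => exit)
  | pop k f, _, exit => fun _ => .pop k f (.goto fun _ => exit)
  | load f, _, exit => fun _ => .load f (.goto fun _ => exit)
  | seq p q, emb, exit => fun
    | .inl l => code p (emb ∘ .inl) (emb (.inr (entry q))) l
    | .inr l => code q (emb ∘ .inr) exit l
  | ite c p q, emb, exit => fun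
    | none => .goto fun v => bif c v then emb (some (.inl (entry p)))
        else emb (some (.inr (entry q)))
    | some (.inl l) => code p (fun l => emb (some (.inl l))) exit l
    | some (.inr l) => code q (fun l => emb (some (.inr l))) exit l
  | loop c p, emb, exit => fun
    | none => .goto fun v => bif c v then emb (some (entry p)) else exit
    | some l => code p (fun l => emb (some l)) (emb none) l

variable [DecidableEq K]

/-- `Exec p v S v' S' t`: started with register `v` and stacks `S`, the program `p` ends with
register `v'` and stacks `S'` after at most `t` steps. -/
inductive Exec : Prog Γ σ → σ → (∀ k, List (Γ k)) → σ → (∀ k, List (Γ k)) → ℕ → Prop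
  | push {k f v S} : Exec (push k f) v S v (update S k (f v :: S k)) 1
  | pop {k f v S} : Exec (pop k f) v S (f v (S k).head?) (update S k (S k).tail) 1
  | load {f v S} : Exec (load f) v S (f v) S 1
  | seq {p q v S v₁ S₁ v₂ S₂ t₁ t₂} :
      Exec p v S v₁ S₁ t₁ → Exec q v₁ S₁ v₂ S₂ t₂ → Exec (seq p q) v S v₂ S₂ (t₁ + t₂)
  | ite_true {c p q v S v₁ S₁ t} :
      c v = true → Exec p v S v₁ S₁ t → Exec (ite c p q) v S v₁ S₁ (t + 1)
  | ite_false {c p q v S v₁ S₁ t} :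
      c v = false → Exec q v S v₁ S₁ t → Exec (ite c p q) v S v₁ S₁ (t + 1)
  | loop_false {c p v S} : c v = false → Exec (loop c p) v S v S 1
  | loop_true {c p v S v₁ S₁ v₂ S₂ t₁ t₂} :
      c v = true → Exec p v S v₁ S₁ t₁ → Exec (loop c p) v₁ S₁ v₂ S₂ t₂ →
        Exec (loop c p) v S v₂ S₂ (t₁ + t₂ + 1)
  | mono {p v S v' S' t t'} : Exec p v S v' S' t → t ≤ t' → Exec p v S v' S' t'

/-- The machine with code `M` gets from the configuration `c` to `c'` in at most `t` steps. -/
def ReachesIn (M : Λ → Turing.TM2.Stmt Γ Λ σ) (c c' : Turing.TM2.Cfg Γ Λ σ) (t : ℕ) : Prop :=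
  Nonempty (StateTransition.EvalsToInTime (Turing.TM2.step M) c (some c') t)

namespace ReachesIn

variable {M : Λ → Turing.TM2.Stmt Γ Λ σ} {c c₁ c₂ c₃ : Turing.TM2.Cfg Γ Λ σ} {t t₁ t₂ : ℕ}

theorem mono (h : ReachesIn M c₁ c₂ t₁) (ht : t₁ ≤ t₂) : ReachesIn M c₁ c₂ t₂ :=
  h.map fun e => ⟨e.toEvalsTo, e.steps_le_m.trans ht⟩

theorem trans (h : ReachesIn M c₁ c₂ t₁) (h' : ReachesIn M c₂ c₃ t₂) :
    ReachesIn M c₁ c₃ (t₁ + t₂) := by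
  obtain ⟨⟨e⟩, ⟨e'⟩⟩ := And.intro h h'
  exact ⟨add_comm t₂ t₁ ▸ e.trans _ _ _ _ _ _ e'⟩

theorem single {l : Λ} {v : σ} {S : ∀ k, List (Γ k)}
    (h : Turing.TM2.stepAux (M l) v S = c) : ReachesIn M ⟨some l, v, S⟩ c 1 :=
  ⟨⟨1, congrArg some h⟩, le_rfl⟩

end ReachesIn

theorem Exec.reachesIn {p : Prog Γ σ} {v v' : σ} {S S' : ∀ k, List (Γ k)} {t : ℕ}
    (h : Exec p v S v' S' t) (M : Λ → Turing.TM2.Stmt Γ Λ σ) (emb : p.Label → Λ) (exit : Λ)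
    (hM : ∀ l, M (emb l) = code p emb exit l) :
    ReachesIn M ⟨some (emb p.entry), v, S⟩ ⟨some exit, v', S'⟩ t := by
  induction h generalizing exit with
  | push | pop | load => exact .single (by rw [hM]; rfl)
  | seq _ _ ih₁ ih₂ =>
    exact (ih₁ _ _ fun l => hM (.inl l)).trans (ih₂ _ _ fun l => hM (.inr l))
  | ite_true hc _ ih =>
    rw [add_comm]
    exact .trans (.single (by rw [hM]; simp [code, entry, hc]))
      (ih (fun l => emb (some (.inl l))) _ fun l => hM (some (.inl l)))
  | ite_false hc _ ih =>
    rw [add_comm]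
    exact .trans (.single (by rw [hM]; simp [code, entry, hc]))
      (ih (fun l => emb (some (.inr l))) _ fun l => hM (some (.inr l)))
  | loop_false hc => exact .single (by rw [hM]; simp [code, entry, hc])
  | loop_true hc _ _ ih₁ ih₂ =>
    rw [add_comm]
    exact .trans (.single (by rw [hM]; simp [code, entry, hc]))
      ((ih₁ (fun l => emb (some l)) _ fun l => hM (some l)).trans (ih₂ emb _ hM))
  | mono _ ht ih => exact (ih emb _ hM).mono ht

/-- Whatever the register holds, `p` leads from the stacks `S` to the stacks `S'` in time `t`. -/
def Runs (p : Prog Γ σ) (S S' : ∀ k, List (Γ k)) (t : ℕ) : Prop :=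
  ∀ v, ∃ v', Exec p v S v' S' t

theorem Runs.seq {p q : Prog Γ σ} {S₁ S₂ S₃ : ∀ k, List (Γ k)} {t₁ t₂ : ℕ}
    (h₁ : Runs p S₁ S₂ t₁) (h₂ : Runs q S₂ S₃ t₂) : Runs (.seq p q) S₁ S₃ (t₁ + t₂) := by
  intro v
  obtain ⟨v₁, h₁⟩ := h₁ v
  obtain ⟨v₂, h₂⟩ := h₂ v₁
  exact ⟨v₂, h₁.seq h₂⟩

theorem Runs.mono {p : Prog Γ σ} {S₁ S₂ : ∀ k, List (Γ k)} {t₁ t₂ : ℕ}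
    (h : Runs p S₁ S₂ t₁) (ht : t₁ ≤ t₂) : Runs p S₁ S₂ t₂ :=
  fun v => (h v).imp fun _ h => h.mono ht

/-- Empty the stack `k`, running `p` after each symbol read. The register records the symbol by
means of `read`, and `c` tells whether the stack was found non-empty. -/
def forEach (k : K) (read : σ → Option (Γ k) → σ) (c : σ → Bool) (p : Prog Γ σ) : Prog Γ σ :=
  .seq (.pop k read) (.loop c (.seq p (.pop k read)))

theorem runs_forEach {k : K} {read : σ → Option (Γ k) → σ} {c : σ → Bool} {p : Prog Γ σ} {t : ℕ}
    (hnone : ∀ v, c (read v none) = false) (hsome : ∀ v y, c (read v (some y)) = true)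
    {F : List (Γ k) → List (Γ k) → ∀ k, List (Γ k)} (hF : ∀ d x, F d x k = x)
    (hp : ∀ d y x v,
      ∃ v', Exec p (read v (some y)) (update (F d (y :: x)) k x) v' (F (y :: d) x) t)
    (d x : List (Γ k)) :
    Runs (forEach k read c p) (F d x) (F (x.reverse ++ d) []) ((t + 2) * x.length + 2) := by
  have pop (v d x) :
      Exec (.pop k read) v (F d x) (read v x.head?) (update (F d x) k x.tail) 1 := by
    simpa only [hF] using Exec.pop (f := read) (v := v) (S := F d x) (k := k)
  suffices hloop : ∀ v, ∃ v', Exec (.loop c (.seq p (.pop k read))) (read v x.head?)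
      (update (F d x) k x.tail) v' (F (x.reverse ++ d) []) ((t + 2) * x.length + 1) from
    fun v => (hloop v).imp fun _ h => ((pop v d x).seq h).mono (by omega)
  induction x generalizing d with
  | nil =>
    intro v
    have hS : update (F d []) k [] = F d [] := by
      simpa only [hF] using Function.update_eq_self k (F d [])
    exact ⟨read v none, hS.symm ▸ .loop_false (hnone v)⟩
  | cons y x ih =>
    intro v
    obtain ⟨v₁, h₁⟩ := hp d y x v
    obtain ⟨v₂, h₂⟩ := ih (y :: d) v₁
    refine ⟨v₂, ?_⟩
    rw [List.reverse_cons, List.append_assoc]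
    exact (Exec.loop_true (hsome v y) (h₁.seq (pop v₁ (y :: d) x)) h₂).mono
      (by rw [List.length_cons]; linarith)

end Prog

end StackProgram

/-! ### Binary trees as data, and programs acting on them -/

namespace StackProgram

open Function (update)

/-- Binary trees, the universal data type of the polynomial time functions below. -/
inductive Data
  | leaf
  | node (a b : Data)

namespace Data

/-- Trees in prefix notation, the form in which they are kept on stacks. -/
def word : Data → List Bool
  | leaf => [false]
  | node a b => true :: (word a ++ word b)

/-- The length of the word of a tree, our measure for the size of an input. -/
def size (t : Data) : ℕ := t.word.length

@[simp] theorem size_leaf : leaf.size = 1 := rfl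

@[simp] theorem size_node (a b : Data) : (node a b).size = a.size + b.size + 1 := by
  simp [size, word]

end Data

/-- The stacks that hold sequences of trees: the main stack and two for temporary storage. -/
inductive DataStack
  | main
  | left
  | right
  deriving DecidableEq

instance : Fintype DataStack :=
  ⟨{.main, .left, .right}, fun k => by cases k <;> decide⟩

/-- The stacks of our machines. A tree is moved by way of the stack `aux`, while `count` holds one
bit for each tree that is still to be read. -/
inductive Stack
  | input
  | reversed
  | output
  | aux
  | count
  | data (k : DataStack)
  deriving DecidableEq, Fintype

/-- The alphabets of the stacks, for input words over `A`. -/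
def Alphabet (A : Type) : Stack → Type
  | .input | .reversed => A
  | .output | .aux | .count | .data _ => Bool

/-- The register holds the input symbol and the bit read last, unless the stack was empty. -/
abbrev Register (A : Type) := Option A × Option Bool

/-- The programs of our machines. -/
abbrev Program (A : Type) := Prog (Alphabet A) (Register A)

variable {A : Type}

/-- The contents of all stacks. -/
structure Config (A : Type) where
  input : List A := []
  reversed : List A := []
  output : List Bool := []
  aux : List Bool := []
  count : List Bool := []
  data : DataStack → List Bool := fun _ => []

namespace Config

/-- The contents of the stacks, as a function of the stack. -/
def contents (C : Config A) : ∀ k, List (Alphabet A k)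
  | .input => C.input
  | .reversed => C.reversed
  | .output => C.output
  | .aux => C.aux
  | .count => C.count
  | .data k => C.data k

variable (C : Config A)

theorem update_input (l : List A) :
    update C.contents .input l = { C with input := l }.contents := by
  funext k; cases k <;> rfl

theorem update_reversed (l : List A) :
    update C.contents .reversed l = { C with reversed := l }.contents := by
  funext k; cases k <;> rfl

theorem update_output (l : List Bool) :
    update C.contents .output l = { C with output := l }.contents := by
  funext k; cases k <;> rfl

theorem update_aux (l : List Bool) : update C.contents .aux l = { C with aux := l }.contents := by
  funext k; cases k <;> rfl

theorem update_count (l : List Bool) :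
    update C.contents .count l = { C with count := l }.contents := by
  funext k; cases k <;> rfl

theorem update_data (k : DataStack) (l : List Bool) :
    update C.contents (.data k) l = { C with data := update C.data k l }.contents := by
  funext j
  cases j with
  | data j =>
    rcases eq_or_ne j k with rfl | h
    · exact (Function.update_self (β := fun k => List (Alphabet A k)) ..).trans
        (Function.update_self j l C.data).symm
    · exact (Function.update_of_ne (β := fun k => List (Alphabet A k)) (by simpa using h) ..).trans
        (Function.update_of_ne (β := fun _ => List Bool) h l C.data).symm
  | _ => rfl

end Config

/-- The contents of the data stacks, given by their components. -/
def triple (m a b : List Bool) : DataStack → List Bool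
  | .main => m
  | .left => a
  | .right => b

section triple

variable (m a b l : List Bool)

theorem triple_nil : triple [] [] [] = fun _ => [] := by
  funext k; cases k <;> rfl

@[simp] theorem triple_main : triple m a b .main = m := rfl
@[simp] theorem triple_left : triple m a b .left = a := rfl
@[simp] theorem triple_right : triple m a b .right = b := rfl

@[simp] theorem update_triple_main : update (triple m a b) .main l = triple l a b := by
  funext k; cases k <;> rfl

@[simp] theorem update_triple_left : update (triple m a b) .left l = triple m l b := by
  funext k; cases k <;> rfl

@[simp] theorem update_triple_right : update (triple m a b) .right l = triple m a l := by
  funext k; cases k <;> rfl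

end triple

namespace Prog

/-- The last attempt to read a bit was successful. -/
def hasBit (v : Register A) : Bool := v.2.isSome

/-- The last bit read. -/
def lastBit (v : Register A) : Bool := v.2.getD false

/-- Record a bit in the register. -/
def readInto (v : Register A) (b : Option Bool) : Register A := (v.1, b)

/-- Push a bit onto the main stack. -/
def pushBit (b : Bool) : Program A := .push (.data .main) fun _ => b

/-- Read a bit of the main stack. -/
def popBit : Program A := .pop (.data .main) readInto

/-- Move one bit of a tree to the stack `aux`. An inner node leaves one more tree to be read, and
a leaf one less. -/
def unloadBit (k : DataStack) : Program A :=
  .seq (.pop (.data k) readInto) <| .seq (.push .aux lastBit) <|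
    .ite lastBit (.push .count fun _ => true) (.pop .count readInto)

/-- Move a tree to the stack `aux`, in reversed order. -/
def unload (k : DataStack) : Program A :=
  .seq (.load fun v => (v.1, some true)) (.loop hasBit (unloadBit k))

/-- Empty the stack `aux`, running `p` after each bit read. -/
def forAux (p : Program A) : Program A := forEach .aux readInto hasBit p

/-- Move the content of the stack `aux` to the stack `k`. -/
def drain (k : DataStack) : Program A := forAux (.push (.data k) lastBit)

/-- Move the content of the stack `aux` to both of the stacks `k` and `k'`. -/
def drainTwice (k k' : DataStack) : Program A :=
  forAux (.seq (.push (.data k) lastBit) (.push (.data k') lastBit))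

/-- Delete the content of the stack `aux`. -/
def discard : Program A := forAux (.load id)

/-- Move a tree from the stack `k` to the stack `k'`. -/
def move (k k' : DataStack) : Program A := .seq (unload k) (drain k')

/-- Duplicate the tree on the main stack. -/
def dup : Program A :=
  .seq (unload .main) (.seq (drainTwice .main .left) (move .left .main))

/-- Delete the tree on the main stack. -/
def drop : Program A := .seq (unload .main) discard

/-- Exchange the two topmost trees of the main stack. -/
def swap : Program A :=
  .seq (move .main .left) (.seq (move .main .right) (.seq (move .left .main) (move .right .main)))

/-- Exchange the second and the third tree of the main stack. -/
def swapUnder : Program A := .seq (move .main .left) (.seq swap (move .left .main))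

section Primitives

variable (C : Config A) (v : Register A) (f : Register A → Bool) (k : DataStack)

theorem exec_push_data : Exec (.push (.data k) f) v C.contents v
    { C with data := update C.data k (f v :: C.data k) }.contents 1 :=
  C.update_data k (f v :: C.data k) ▸ .push

theorem exec_pop_data : Exec (.pop (.data k) readInto) v C.contents (v.1, (C.data k).head?)
    { C with data := update C.data k (C.data k).tail }.contents 1 :=
  C.update_data k (C.data k).tail ▸ .pop

theorem exec_push_aux :
    Exec (.push .aux f) v C.contents v { C with aux := f v :: C.aux }.contents 1 :=
  C.update_aux (f v :: C.aux) ▸ .push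

theorem exec_push_count :
    Exec (.push .count f) v C.contents v { C with count := f v :: C.count }.contents 1 :=
  C.update_count (f v :: C.count) ▸ .push

theorem exec_pop_count : Exec (.pop .count readInto) v C.contents (v.1, C.count.head?)
    { C with count := C.count.tail }.contents 1 :=
  C.update_count C.count.tail ▸ .pop

end Primitives

section Trees

variable {C : Config A} {v v' : Register A} {k k' : DataStack} {r : List Bool}

theorem exec_unloadBit_true (hr : C.data k = true :: r) :
    Exec (unloadBit k) v C.contents (v.1, some true)
      { C with
        aux := true :: C.aux, count := true :: C.count, data := update C.data k r }.contents 4 := by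
  have hpop := exec_pop_data C v k
  rw [hr] at hpop
  exact hpop.seq ((exec_push_aux _ _ _).seq (.ite_true rfl (exec_push_count _ _ _)))

theorem exec_unloadBit_false (hr : C.data k = false :: r) :
    Exec (unloadBit k) v C.contents (v.1, C.count.head?)
      { C with
        aux := false :: C.aux, count := C.count.tail, data := update C.data k r }.contents 4 := by
  have hpop := exec_pop_data C v k
  rw [hr] at hpop
  exact hpop.seq ((exec_push_aux _ _ _).seq (.ite_false rfl (exec_pop_count _ _)))

theorem exec_unload_loop {S : ∀ k, List (Alphabet A k)} {T : ℕ} (t : Data)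
    (hr : C.data k = t.word ++ r) (hv : hasBit v = true)
    (h : Exec (.loop hasBit (unloadBit k)) (v.1, C.count.head?)
      { C with
        aux := t.word.reverse ++ C.aux, count := C.count.tail, data := update C.data k r }.contents
      v' S T) :
    Exec (.loop hasBit (unloadBit k)) v C.contents v' S (T + 5 * t.size) := by
  induction t generalizing C v r T with
  | leaf => exact (Exec.loop_true hv (exec_unloadBit_false hr) h).mono (by simp; omega)
  | node a b iha ihb =>
    rw [Data.word, List.cons_append, List.append_assoc] at hr
    refine (Exec.loop_true hv (exec_unloadBit_true hr) ?_).mono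
      (t := 4 + (T + 5 * b.size + 5 * a.size) + 1) (by rw [Data.size_node]; omega)
    refine iha (Function.update_self ..) rfl (ihb (Function.update_self ..) rfl ?_)
    simpa [Data.word] using h

theorem exec_unload (t : Data) (hr : C.data k = t.word ++ r) (hC : C.count = []) :
    Exec (unload k) v C.contents (v.1, none)
      { C with aux := t.word.reverse ++ C.aux, data := update C.data k r }.contents
      (5 * t.size + 2) := by
  refine (Exec.load.seq (exec_unload_loop t hr rfl ?_)).mono (t := 1 + (1 + 5 * t.size)) (by omega)
  rw [hC]
  exact .loop_false rfl

theorem runs_forAux {p : Program A} {t : ℕ} {F : List Bool → List Bool → Config A}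
    (hF : ∀ d x, (F d x).aux = x)
    (hp : ∀ d y x w,
      Exec p (w, some y) { F d (y :: x) with aux := x }.contents (w, some y)
        (F (y :: d) x).contents t)
    (d x : List Bool) :
    Runs (forAux p) (F d x).contents (F (x.reverse ++ d) []).contents ((t + 2) * x.length + 2) :=
  runs_forEach (Γ := Alphabet A) (k := .aux) (F := fun d x => (F d x).contents) (c := hasBit)
    (read := readInto) (fun _ => rfl) (fun _ _ => rfl) (fun d x => hF d x)
    (fun d y x v => ⟨_, (F d (y :: x)).update_aux x ▸ hp d y x v.1⟩) d x

theorem runs_drain (C : Config A) (k : DataStack) :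
    Runs (drain k) C.contents
      { C with aux := [], data := update C.data k (C.aux.reverse ++ C.data k) }.contents
      (3 * C.aux.length + 2) := by
  have h := runs_forAux (p := .push (.data k) lastBit) (t := 1)
    (F := fun d x => { C with aux := x, data := update C.data k (d ++ C.data k) }) (fun _ _ => rfl)
    (fun d y x w => by
      simpa [lastBit] using exec_push_data
        { C with aux := x, data := update C.data k (d ++ C.data k) } (w, some y) lastBit k)
    [] C.aux
  simpa [drain] using h

theorem runs_drainTwice (C : Config A) (hk : k ≠ k') :
    Runs (drainTwice k k') C.contents
      { C with
        aux := []
        data := update (update C.data k (C.aux.reverse ++ C.data k)) k'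
          (C.aux.reverse ++ C.data k') }.contents
      (4 * C.aux.length + 2) := by
  let D d x : Config A :=
    { C with aux := x, data := update (update C.data k (d ++ C.data k)) k' (d ++ C.data k') }
  have h := runs_forAux (F := D) (t := 2) (fun _ _ => rfl)
    (fun d y x w => by
      have := (exec_push_data (D d x) (w, some y) lastBit k).seq
        (exec_push_data _ (w, some y) lastBit k')
      simpa [D, lastBit, hk, hk.symm, Function.update_comm hk.symm] using this)
    [] C.aux
  simpa [D, drainTwice] using h

theorem runs_discard (C : Config A) :
    Runs discard C.contents { C with aux := [] }.contents (3 * C.aux.length + 2) :=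
  runs_forAux (F := fun _ x => { C with aux := x }) (fun _ _ => rfl) (fun _ _ _ _ => .load) [] C.aux

/-- Stack contents between two operations on data. -/
def dataStacks (d : DataStack → List Bool) : ∀ k, List (Alphabet A k) :=
  ({ data := d } : Config A).contents

variable {d : DataStack → List Bool}

theorem runs_move (t : Data) (hr : d k = t.word ++ r) :
    Runs (move k k' : Program A) (dataStacks d)
      (dataStacks (update (update d k r) k' (t.word ++ update d k r k'))) (8 * t.size + 4) := by
  intro v
  obtain ⟨v', h⟩ := runs_drain { aux := t.word.reverse, data := update d k r } k' (v.1, none)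
  rw [List.reverse_reverse, List.length_reverse] at h
  have hunload := exec_unload (C := { data := d }) (v := v) t hr rfl
  rw [List.append_nil] at hunload
  exact ⟨v', (hunload.seq h).mono (by rw [Data.size]; omega)⟩

end Trees

section MainStack

variable {m a b : List Bool}

theorem runs_pushBit (y : Bool) :
    Runs (pushBit y : Program A) (dataStacks (triple m a b)) (dataStacks (triple (y :: m) a b)) 1 :=
  fun v => ⟨v, by
    simpa [pushBit, dataStacks] using
      exec_push_data (A := A) { data := triple m a b } v (fun _ => y) .main⟩

theorem exec_popBit (y : Bool) (v : Register A) :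
    Exec popBit v (dataStacks (triple (y :: m) a b)) (v.1, some y)
      (dataStacks (triple m a b)) 1 := by
  simpa [popBit, dataStacks] using exec_pop_data { data := triple (y :: m) a b } v .main

theorem runs_dup (t : Data) :
    Runs (dup : Program A) (dataStacks (triple (t.word ++ m) a b))
      (dataStacks (triple (t.word ++ (t.word ++ m)) a b)) (17 * t.size + 8) := by
  intro v
  have hunload := exec_unload (A := A) (C := { data := triple (t.word ++ m) a b }) (v := v)
    (k := .main) t rfl rfl
  obtain ⟨v₁, h₁⟩ := runs_drainTwice (A := A) (k := .main) (k' := .left)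
    { aux := t.word.reverse, data := triple m a b } (by decide) (v.1, none)
  obtain ⟨v₂, h₂⟩ := runs_move (A := A) (d := triple (t.word ++ m) (t.word ++ a) b)
    (k := .left) (k' := .main) t rfl v₁
  rw [List.append_nil, update_triple_main] at hunload
  rw [List.reverse_reverse, List.length_reverse, update_triple_main, update_triple_left] at h₁
  rw [update_triple_left, update_triple_main] at h₂
  exact ⟨v₂, (hunload.seq (h₁.seq h₂)).mono (by rw [Data.size]; omega)⟩

theorem runs_drop (t : Data) :
    Runs (drop : Program A) (dataStacks (triple (t.word ++ m) a b)) (dataStacks (triple m a b))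
      (8 * t.size + 4) := by
  intro v
  have hunload := exec_unload (A := A) (C := { data := triple (t.word ++ m) a b }) (v := v)
    (k := .main) t rfl rfl
  rw [List.append_nil, update_triple_main] at hunload
  obtain ⟨v', h⟩ :=
    runs_discard (A := A) { aux := t.word.reverse, data := triple m a b } (v.1, none)
  rw [List.length_reverse] at h
  exact ⟨v', (hunload.seq h).mono (by rw [Data.size]; omega)⟩

theorem runs_swap (s t : Data) :
    Runs (swap : Program A) (dataStacks (triple (s.word ++ (t.word ++ m)) a b))
      (dataStacks (triple (t.word ++ (s.word ++ m)) a b)) (16 * (s.size + t.size) + 16) := by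
  have h₁ := runs_move (A := A) (k := .main) (k' := .left)
    (d := triple (s.word ++ (t.word ++ m)) a b) s rfl
  have h₂ := runs_move (A := A) (k := .main) (k' := .right)
    (d := triple (t.word ++ m) (s.word ++ a) b) t rfl
  have h₃ := runs_move (A := A) (k := .left) (k' := .main)
    (d := triple m (s.word ++ a) (t.word ++ b)) s rfl
  have h₄ := runs_move (A := A) (k := .right) (k' := .main)
    (d := triple (s.word ++ m) a (t.word ++ b)) t rfl
  simp only [update_triple_main, update_triple_left, update_triple_right, triple_main,
    triple_left, triple_right] at h₁ h₂ h₃ h₄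
  exact (h₁.seq (h₂.seq (h₃.seq h₄))).mono (by omega)

theorem runs_swapUnder (r s t : Data) :
    Runs (swapUnder : Program A) (dataStacks (triple (r.word ++ (s.word ++ (t.word ++ m))) a b))
      (dataStacks (triple (r.word ++ (t.word ++ (s.word ++ m))) a b))
      (16 * (r.size + s.size + t.size) + 24) := by
  have h₁ := runs_move (A := A) (k := .main) (k' := .left)
    (d := triple (r.word ++ (s.word ++ (t.word ++ m))) a b) r rfl
  have h₂ := runs_move (A := A) (k := .left) (k' := .main)
    (d := triple (t.word ++ (s.word ++ m)) (r.word ++ a) b) r rfl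
  simp only [update_triple_main, update_triple_left, triple_main, triple_left] at h₁ h₂
  exact (h₁.seq ((runs_swap s t).seq h₂)).mono (by omega)

end MainStack

end Prog

end StackProgram

/-! ### Polynomial time functions -/

namespace StackProgram

open Prog Polynomial
open Function (update)

theorem polynomial_eval_mono (P : ℕ[X]) : Monotone fun n => P.eval n := by
  intro m n h
  induction P using Polynomial.induction_on' with
  | add p q hp hq => simpa using Nat.add_le_add hp hq
  | monomial k c => simpa using Nat.mul_le_mul_left c (Nat.pow_le_pow_left h k)

variable {A : Type}

/-- Stack contents between two operations on the main stack. -/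
abbrev mainStack (m : List Bool) : ∀ k, List (Alphabet A k) := dataStacks (triple m [] [])

namespace Prog

/-- Read a bit of the main stack and branch according to it. -/
def test (p q : Program A) : Program A := .seq popBit (.ite lastBit p q)

/-- Read bits of the main stack, run `p` after each bit `true`, and stop at a bit `false`. -/
def repeatWhile (p : Program A) : Program A := .seq popBit (.loop lastBit (.seq p popBit))

/-- Push a word onto the main stack. -/
def pushWord : List Bool → Program A
  | [] => .load id
  | y :: w => .seq (pushWord w) (pushBit y)

section Seq

variable {K : Type*} [DecidableEq K] {Γ : K → Type*} {σ : Type*}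

theorem Exec.exists_of_seq {p q : Prog Γ σ} {v v' : σ} {S S' : ∀ k, List (Γ k)} {t : ℕ}
    (h : Exec (.seq p q) v S v' S' t) :
    ∃ v₁ S₁ t₁ t₂, Exec p v S v₁ S₁ t₁ ∧ Exec q v₁ S₁ v' S' t₂ ∧ t₁ + t₂ ≤ t := by
  generalize hr : Prog.seq p q = r at h
  induction h with
  | seq h₁ h₂ => cases hr; exact ⟨_, _, _, _, h₁, h₂, le_rfl⟩
  | mono _ ht ih =>
    obtain ⟨v₁, S₁, t₁, t₂, h₁, h₂, h⟩ := ih hr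
    exact ⟨v₁, S₁, t₁, t₂, h₁, h₂, h.trans ht⟩
  | _ => cases hr

end Seq

variable {p q : Program A} {m : List Bool} {S S' : ∀ k, List (Alphabet A k)} {t t' : ℕ}

theorem runs_popBit (y : Bool) :
    Runs (popBit : Program A) (mainStack (y :: m)) (mainStack m) 1 :=
  fun v => ⟨_, exec_popBit y v⟩

theorem runs_test_true (h : Runs p (mainStack m) S t) :
    Runs (test p q) (mainStack (true :: m)) S (t + 2) := by
  intro v
  obtain ⟨v', h⟩ := h (v.1, some true)
  exact ⟨v', ((exec_popBit true v).seq (.ite_true rfl h)).mono (by omega)⟩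

theorem runs_test_false (h : Runs q (mainStack m) S t) :
    Runs (test p q) (mainStack (false :: m)) S (t + 2) := by
  intro v
  obtain ⟨v', h⟩ := h (v.1, some false)
  exact ⟨v', ((exec_popBit false v).seq (.ite_false rfl h)).mono (by omega)⟩

theorem runs_repeatWhile_true (h : Runs p (mainStack m) S t) (h' : Runs (repeatWhile p) S S' t') :
    Runs (repeatWhile p) (mainStack (true :: m)) S' (t + t' + 2) := by
  intro v
  obtain ⟨v₁, h₁⟩ := h (v.1, some true)
  obtain ⟨v₂, h₂⟩ := h' v₁
  obtain ⟨v₃, S₃, t₁, t₂, hpop, hloop, ht⟩ := h₂.exists_of_seq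
  exact ⟨v₂, ((exec_popBit true v).seq (.loop_true rfl (h₁.seq hpop) hloop)).mono (by omega)⟩

theorem runs_repeatWhile_false (p : Program A) (m : List Bool) :
    Runs (repeatWhile p) (mainStack (false :: m)) (mainStack m) 2 :=
  fun v => ⟨_, (exec_popBit false v).seq (.loop_false rfl)⟩

theorem exec_pushWord (C : Config A) (v : Register A) : ∀ w : List Bool,
    Exec (pushWord w) v C.contents v
      { C with data := update C.data .main (w ++ C.data .main) }.contents (w.length + 1)
  | [] => by
    rw [List.nil_append, Function.update_eq_self]
    exact .load
  | y :: w => by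
    have h := (exec_pushWord C v w).seq (exec_push_data
      { C with data := update C.data .main (w ++ C.data .main) } v (fun _ => y) .main)
    simp only [Function.update_self, Function.update_idem] at h
    exact h

theorem runs_pushWord (m w : List Bool) :
    Runs (pushWord w : Program A) (mainStack m) (mainStack (w ++ m)) (w.length + 1) :=
  fun v => ⟨v, by
    have h := exec_pushWord (A := A) { data := triple m [] [] } v w
    rw [update_triple_main] at h
    exact h⟩

end Prog

/-- The program `p` turns the tree `s` on the main stack into the tree `t`, and time and size
are bounded by the polynomial `P`. -/
def Transforms (p : Program A) (P : ℕ[X]) (s t : Data) : Prop :=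
  t.size ≤ P.eval s.size ∧
    ∀ m, Runs p (mainStack (s.word ++ m)) (mainStack (t.word ++ m)) (P.eval s.size)

variable (A) in
/-- Some program transforms the tree `u i` into `w i`, for all `i`, in polynomial time. The index
`i` need not be determined by `u i`, which allows for functions on subtypes. -/
def PolyMap {ι : Type*} (u w : ι → Data) : Prop :=
  ∃ (p : Program A) (P : ℕ[X]), ∀ i, Transforms p P (u i) (w i)

/-- The trees that represent the truth values. -/
def Data.ofBool : Bool → Data
  | true => .node .leaf .leaf
  | false => .leaf

namespace PolyMap

variable {ι κ : Type*} {u w z : ι → Data}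

theorem refl (u : ι → Data) : PolyMap A u u :=
  ⟨.load id, X + 1, fun i => ⟨by simp, fun m v => ⟨v, Exec.load.mono (by simp)⟩⟩⟩

theorem reindex (h : PolyMap A u w) (f : κ → ι) : PolyMap A (fun k => u (f k)) fun k => w (f k) :=
  let ⟨p, P, h⟩ := h
  ⟨p, P, fun i => h (f i)⟩

theorem trans (h₁ : PolyMap A u w) (h₂ : PolyMap A w z) : PolyMap A u z := by
  obtain ⟨p, P, hp⟩ := h₁
  obtain ⟨q, Q, hq⟩ := h₂
  refine ⟨.seq p q, P + Q.comp P, fun i => ?_⟩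
  have hQ : Q.eval (w i).size ≤ Q.eval (P.eval (u i).size) := polynomial_eval_mono Q (hp i).1
  rw [Transforms, eval_add, eval_comp]
  exact ⟨(hq i).1.trans (hQ.trans (Nat.le_add_left ..)),
    fun m => (((hp i).2 m).seq ((hq i).2 m)).mono (Nat.add_le_add_left hQ _)⟩

theorem pair (h₁ : PolyMap A u w) (h₂ : PolyMap A u z) :
    PolyMap A u fun i => .node (w i) (z i) := by
  obtain ⟨p, P, hp⟩ := h₁
  obtain ⟨q, Q, hq⟩ := h₂
  refine ⟨.seq dup <| .seq p <| .seq swap <| .seq q <| .seq swap (pushBit true),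
    40 * X + 50 + 40 * P + 40 * Q, fun i => ?_⟩
  have hw := (hp i).1
  have hz := (hq i).1
  simp only [Transforms, eval_add, eval_mul, eval_X, eval_ofNat, Data.size_node, Data.word,
    List.cons_append, List.append_assoc]
  refine ⟨by omega, fun m => ?_⟩
  exact ((runs_dup (u i)).seq <| ((hp i).2 _).seq <| (runs_swap (w i) (u i)).seq <|
    ((hq i).2 _).seq <| (runs_swap (z i) (w i)).seq (runs_pushBit true)).mono (by omega)

theorem left (w z : ι → Data) : PolyMap A (fun i => .node (w i) (z i)) w := by
  refine ⟨.seq popBit (.seq swap drop), 30 * X + 30, fun i => ?_⟩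
  simp only [Transforms, eval_add, eval_mul, eval_X, eval_ofNat, Data.size_node, Data.word,
    List.cons_append, List.append_assoc]
  exact ⟨by omega, fun m => ((runs_popBit true).seq
    ((runs_swap (w i) (z i)).seq (runs_drop (z i)))).mono (by omega)⟩

theorem right (w z : ι → Data) : PolyMap A (fun i => .node (w i) (z i)) z := by
  refine ⟨.seq popBit drop, 30 * X + 30, fun i => ?_⟩
  simp only [Transforms, eval_add, eval_mul, eval_X, eval_ofNat, Data.size_node, Data.word,
    List.cons_append, List.append_assoc]
  exact ⟨by omega, fun m => ((runs_popBit true).seq (runs_drop (w i))).mono (by omega)⟩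

theorem const (u : ι → Data) (t : Data) : PolyMap A u fun _ => t := by
  refine ⟨.seq drop (pushWord t.word), 8 * X + 5 + C t.size, fun i => ?_⟩
  simp only [Transforms, eval_add, eval_mul, eval_X, eval_ofNat, eval_C]
  exact ⟨by omega, fun m => ((runs_drop (u i)).seq (runs_pushWord m t.word)).mono
    (by simp only [Data.size]; omega)⟩

theorem isNode {b : ι → Bool} (h : ∀ i, b i = true ↔ u i ≠ .leaf) :
    PolyMap A u fun i => .ofBool (b i) := by
  refine ⟨test (.seq drop (.seq drop (pushWord (Data.ofBool true).word)))
    (pushWord (Data.ofBool false).word), 20 * X + 20, fun i => ?_⟩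
  simp only [Transforms, eval_add, eval_mul, eval_X, eval_ofNat]
  cases hu : u i with
  | leaf =>
    have hb : b i = false := by rw [← Bool.not_eq_true, h i, hu]; simp
    rw [hb]
    exact ⟨by simp [Data.ofBool], fun m => (runs_test_false (runs_pushWord m _)).mono
      (by simp [Data.ofBool, Data.word])⟩
  | node s t =>
    have hb : b i = true := by rw [h i, hu]; simp
    rw [hb, Data.word, Data.size_node]
    simp only [List.cons_append, List.append_assoc]
    exact ⟨by simp [Data.ofBool], fun m => (runs_test_true ((runs_drop s).seq
      ((runs_drop t).seq (runs_pushWord m _)))).mono (by simp [Data.ofBool, Data.word]; omega)⟩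

theorem branch {b : ι → Bool} (hb : PolyMap A u fun i => .ofBool (b i))
    (h₁ : PolyMap A (fun i : {i // b i = true} => u i) fun i => w i)
    (h₂ : PolyMap A (fun i : {i // b i = false} => u i) fun i => w i) : PolyMap A u w := by
  obtain ⟨p, P, hp⟩ := hb
  obtain ⟨q, Q, hq⟩ := h₁
  obtain ⟨q', Q', hq'⟩ := h₂
  refine ⟨.seq dup <| .seq p <| test (.seq popBit (.seq popBit q)) q',
    17 * X + 20 + P + Q + Q', fun i => ?_⟩
  simp only [Transforms, eval_add, eval_mul, eval_X, eval_ofNat]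
  have hcond m : Runs p (mainStack ((u i).word ++ m)) (mainStack ((Data.ofBool (b i)).word ++ m))
      (P.eval (u i).size) := (hp i).2 m
  cases hbi : b i with
  | true =>
    have hbranch : Transforms q Q (u i) (w i) := hq ⟨i, hbi⟩
    obtain ⟨hsize, hrun⟩ := hbranch
    rw [hbi] at hcond
    exact ⟨by omega, fun m => ((runs_dup (u i)).seq <| (hcond _).seq <| runs_test_true <|
      (runs_popBit _).seq <| (runs_popBit _).seq (hrun m)).mono (by omega)⟩
  | false =>
    have hbranch : Transforms q' Q' (u i) (w i) := hq' ⟨i, hbi⟩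
    obtain ⟨hsize, hrun⟩ := hbranch
    rw [hbi] at hcond
    exact ⟨by omega, fun m => ((runs_dup (u i)).seq <| (hcond _).seq <|
      runs_test_false (hrun m)).mono (by omega)⟩

end PolyMap

/-- A representation of the elements of a type by binary trees. -/
class Coded (α : Type*) where
  /-- The tree that represents an element. -/
  toData : α → Data

open Coded

variable {α β γ σ : Type*} [Coded α] [Coded β] [Coded γ] [Coded σ]

/-- The size of the representation of an element. -/
def size (x : α) : ℕ := (toData x).size

/-- The representation of lists. -/
def listToData : List α → Data
  | [] => .leaf
  | a :: l => .node (toData a) (listToData l)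

instance : Coded Bool := ⟨.ofBool⟩
instance : Coded Unit := ⟨fun _ => .leaf⟩
instance : Coded (α × β) := ⟨fun x => .node (toData x.1) (toData x.2)⟩
instance : Coded (List α) := ⟨listToData⟩

theorem size_toData (x : α) : (toData x).size = size x := rfl

@[simp] theorem size_mk (x : α) (y : β) : size (x, y) = size x + size y + 1 := by
  simp [size, toData]

@[simp] theorem size_nil : size ([] : List α) = 1 := rfl

@[simp] theorem size_cons (x : α) (l : List α) : size (x :: l) = size x + size l + 1 := by
  simp [size, toData, listToData]

theorem length_lt_size (l : List α) : l.length < size l := by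
  induction l with
  | nil => simp
  | cons x l ih => simp only [List.length_cons, size_cons]; omega

variable (A) in
/-- The function `f` is computable in polynomial time, with respect to the representations of
its arguments and values as binary trees. -/
def PolyTime (f : α → β) : Prop := PolyMap A (fun x => toData x) fun x => toData (f x)

namespace Prog

/-- Fold over the list on the main stack with the function that `p` computes. The tree below the
list holds a parameter and the accumulator. -/
def foldList (p : Program A) : Program A :=
  repeatWhile (.seq swapUnder (.seq (pushBit true) (.seq p swap)))

theorem runs_foldList {p : Program A} {P : ℕ[X]} {h : γ → σ → α → σ}
    (hp : ∀ x : γ × σ × α, Transforms p P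
      (.node (toData x.2.2) (.node (toData x.1) (toData x.2.1)))
      (.node (toData x.1) (toData (h x.1 x.2.1 x.2.2))))
    (m : List Bool) (c : γ) (N : ℕ) (hc : size c ≤ N) : ∀ (l : List α) (s : σ), size l ≤ N →
      (∀ l', l' <+: l → size (l'.foldl (h c) s) ≤ N) →
      Runs (foldList p)
        (mainStack ((toData l).word ++ ((Data.node (toData c) (toData s)).word ++ m)))
        (mainStack ((Data.node (toData c) (toData (l.foldl (h c) s))).word ++ m))
        (l.length * (100 * N + 100 + P.eval (4 * N + 4)) + 2)
  | [], s, _, _ => (runs_repeatWhile_false _ _).mono (by simp)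
  | x :: l, s, hl, hs => by
    have hsl : size x + size l + 1 ≤ N := by simpa using hl
    have hacc : size s ≤ N := hs [] ⟨_, rfl⟩
    have hacc' : size (h c s x) ≤ N := hs [x] (by simp)
    have hstep : Runs p
        (mainStack (true :: ((toData x).word ++ ((Data.node (toData c) (toData s)).word ++
          ((toData l).word ++ m)))))
        (mainStack ((Data.node (toData c) (toData (h c s x))).word ++ ((toData l).word ++ m)))
        (P.eval (4 * N + 4)) := by
      have hbound : (Data.node (toData x) (.node (toData c) (toData s))).size ≤ 4 * N + 4 := by
        simp only [Data.size_node, size_toData]; omega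
      simpa only [Data.word, List.cons_append, List.append_assoc] using
        ((hp (c, s, x)).2 ((toData l).word ++ m)).mono (polynomial_eval_mono P hbound)
    have hrest := runs_foldList hp m c N hc l (h c s x) (by omega) fun l' hl' => by
      simpa using hs (x :: l') (by simpa using hl')
    have hbody := (runs_swapUnder (toData x) (toData l) (.node (toData c) (toData s))).seq <|
      (runs_pushBit true).seq <| hstep.seq <| runs_swap _ (toData l)
    rw [← List.append_assoc] at hbody
    refine (runs_repeatWhile_true hbody hrest).mono ?_
    have hlist : (toData l).size = size l := rfl
    simp only [Data.size_node, size_toData, List.length_cons, Nat.add_mul] at *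
    omega

end Prog

theorem PolyMap.foldl {f : γ → List α} {g : γ → σ} {h : γ → σ → α → σ}
    (hh : PolyMap A
      (fun x : γ × σ × α => .node (toData x.2.2) (.node (toData x.1) (toData x.2.1)))
      fun x => .node (toData x.1) (toData (h x.1 x.2.1 x.2.2)))
    (B : ℕ[X]) (hB : ∀ c l, l <+: f c → size (l.foldl (h c) (g c)) ≤ B.eval (size c)) :
    PolyMap A (fun c => .node (toData (f c)) (.node (toData c) (toData (g c))))
      fun c => .node (toData c) (toData ((f c).foldl (h c) (g c))) := by
  obtain ⟨p, P, hp⟩ := hh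
  refine ⟨.seq popBit (foldList p),
    X * (100 * (X + B) + 100 + P.comp (4 * (X + B) + 4)) + 3 + (X + B), fun c => ?_⟩
  obtain ⟨n, hn⟩ : ∃ n, size (f c) + (size c + size (g c) + 1) + 1 = n := ⟨_, rfl⟩
  have hlength := length_lt_size (f c)
  have hBn : B.eval (size c) ≤ B.eval n := polynomial_eval_mono B (by omega)
  have hresult := hB c (f c) (List.prefix_refl _)
  have hloop m := (runs_popBit true).seq (runs_foldList hp m c (n + B.eval n) (by omega) (f c) (g c)
    (by omega) fun l hl => (hB c l hl).trans (by omega))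
  have htime := Nat.mul_le_mul_right (100 * (n + B.eval n) + 100 + P.eval (4 * (n + B.eval n) + 4))
    (show (f c).length ≤ n by omega)
  simp only [Transforms, Data.size_node, size_toData, hn, eval_add, eval_mul, eval_X, eval_comp,
    eval_ofNat]
  refine ⟨by omega, fun m => ?_⟩
  simpa only [Data.word, List.cons_append, List.append_assoc] using (hloop m).mono (by omega)

end StackProgram

/-! ### A calculus of polynomial time functions -/

namespace StackProgram

open Polynomial Coded

section Size

theorem size_bool_le : ∀ b : Bool, size b ≤ 3
  | true => le_rfl
  | false => by decide

variable {α : Type*} [Coded α]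

theorem size_le_of_mem {a : α} {l : List α} (h : a ∈ l) : size a < size l := by
  induction l with
  | nil => simp at h
  | cons b l ih =>
    rw [size_cons]
    rcases List.mem_cons.1 h with rfl | h
    · omega
    · have := ih h; omega

theorem size_tail_le : ∀ l : List α, size l.tail ≤ size l
  | [] => le_rfl
  | a :: l => by rw [List.tail_cons, size_cons]; omega

@[simp] theorem size_append (l m : List α) : size (l ++ m) + 1 = size l + size m := by
  induction l with
  | nil => rw [List.nil_append, size_nil]; omega
  | cons a l ih => rw [List.cons_append, size_cons, size_cons]; omega

end Size

section Folds

variable {α σ : Type*}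

theorem size_foldl_le [Coded σ] {h : σ → α → σ} {K : ℕ} : ∀ (l : List α) (s : σ),
    (∀ a ∈ l, ∀ s, size (h s a) ≤ size s + K) → size (l.foldl h s) ≤ size s + l.length * K
  | [], s, _ => by simp
  | a :: l, s, hl => by
    have htail := size_foldl_le l (h s a) fun b hb => hl b (List.mem_cons_of_mem a hb)
    have hhead := hl a List.mem_cons_self s
    rw [List.foldl_cons, List.length_cons, Nat.add_mul]
    omega

theorem foldl_snd_eq_append_take {ν : Type*} : ∀ (l : List α) (n : List ν) (m : List α),
    (l.foldl (fun (s : List ν × List α) a => if s.1.isEmpty = true then s else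
      (s.1.tail, s.2 ++ [a])) (n, m)).2 = m ++ l.take n.length
  | [], n, m => by simp
  | a :: l, [], m => by simpa using foldl_snd_eq_append_take l ([] : List ν) m
  | a :: l, x :: n, m => by simpa using foldl_snd_eq_append_take l n (m ++ [a])

/-- One step of the comparison of two lists: `s.1` is the part of the second list that is not yet
compared, `s.2` tells whether all comparisons succeeded. -/
def compareStep [DecidableEq α] (s : List α × Bool) (a : α) : List α × Bool :=
  (s.1.tail, s.2 && (!s.1.isEmpty && decide (a = s.1.headD a)))

theorem foldl_compareStep [DecidableEq α] : ∀ (l m : List α) (b : Bool),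
      ((l.foldl compareStep (m, b)).2 && (l.foldl compareStep (m, b)).1.isEmpty) =
        (b && decide (l = m))
  | [], m, b => by cases m <;> simp
  | a :: l, [], b => by
    rw [List.foldl_cons, compareStep, foldl_compareStep l]; simp
  | a :: l, a' :: m, b => by
    rw [List.foldl_cons, compareStep, foldl_compareStep l]; simp [Bool.and_assoc]; congr

end Folds

namespace PolyTime

variable {A : Type} {α β γ δ σ ν : Type*}
  [Coded α] [Coded β] [Coded γ] [Coded δ] [Coded σ] [Coded ν]

theorem exists_size_le {f : α → β} (hf : PolyTime A f) :
    ∃ P : ℕ[X], ∀ x, size (f x) ≤ P.eval (size x) :=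
  let ⟨_, P, h⟩ := hf
  ⟨P, fun x => (h x).1⟩

theorem of_toData {f : α → β} (h : ∀ x, toData (f x) = toData x) : PolyTime A f := by
  simpa only [PolyTime, h] using PolyMap.refl (A := A) fun x : α => toData x

theorem id : PolyTime A fun x : α => x := of_toData fun _ => rfl

theorem comp {g : β → γ} {f : α → β} (hg : PolyTime A g) (hf : PolyTime A f) :
    PolyTime A fun x => g (f x) :=
  PolyMap.trans hf (PolyMap.reindex hg f)

theorem pair {f : α → β} {g : α → γ} (hf : PolyTime A f) (hg : PolyTime A g) :
    PolyTime A fun x => (f x, g x) := PolyMap.pair hf hg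

theorem comp₂ {g : β → γ → δ} {f₁ : α → β} {f₂ : α → γ}
    (hg : PolyTime A fun x : β × γ => g x.1 x.2) (h₁ : PolyTime A f₁) (h₂ : PolyTime A f₂) :
    PolyTime A fun x => g (f₁ x) (f₂ x) := hg.comp (h₁.pair h₂)

theorem const (y : β) : PolyTime A fun _ : α => y := PolyMap.const _ _

theorem fst {f : α → β × γ} (hf : PolyTime A f) : PolyTime A fun x => (f x).1 :=
  PolyMap.trans hf (PolyMap.left _ _)

theorem snd {f : α → β × γ} (hf : PolyTime A f) : PolyTime A fun x => (f x).2 :=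
  PolyMap.trans hf (PolyMap.right _ _)

theorem cons {f : α → β} {g : α → List β} (hf : PolyTime A f) (hg : PolyTime A g) :
    PolyTime A fun x => f x :: g x := PolyMap.pair hf hg

theorem ite {b : α → Bool} {f g : α → β} (hb : PolyTime A b) (hf : PolyTime A f)
    (hg : PolyTime A g) : PolyTime A fun x => if b x = true then f x else g x := by
  refine PolyMap.branch (b := b) hb ?_ ?_
  · have h : ∀ i : {i // b i = true}, (if b i = true then f i else g i) = f i :=
      fun i => if_pos i.2
    simpa only [h] using PolyMap.reindex hf fun i : {i // b i = true} => i.1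
  · have h : ∀ i : {i // b i = false}, (if b i = true then f i else g i) = g i :=
      fun i => if_neg (by simp [i.2])
    simpa only [h] using PolyMap.reindex hg fun i : {i // b i = false} => i.1

theorem not {f : α → Bool} (hf : PolyTime A f) : PolyTime A fun x => !f x := by
  convert hf.ite (const false) (const true) using 2 with x
  cases f x <;> rfl

theorem and {f g : α → Bool} (hf : PolyTime A f) (hg : PolyTime A g) :
    PolyTime A fun x => f x && g x := by
  convert hf.ite hg (const false) using 2 with x
  cases f x <;> rfl

theorem or {f g : α → Bool} (hf : PolyTime A f) (hg : PolyTime A g) :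
    PolyTime A fun x => f x || g x := by
  convert hf.ite (const true) hg using 2 with x
  cases f x <;> rfl

theorem bool_eq {f g : γ → Bool} (hf : PolyTime A f) (hg : PolyTime A g) :
    PolyTime A fun c => decide (f c = g c) := by
  convert hf.ite hg hg.not using 2 with c
  cases f c <;> cases g c <;> rfl

theorem isEmpty {f : α → List β} (hf : PolyTime A f) : PolyTime A fun x => (f x).isEmpty := by
  have h : PolyTime A fun x => !(f x).isEmpty := PolyMap.trans hf (PolyMap.isNode fun x => by
    cases f x <;> simp [toData, listToData])
  simpa only [Bool.not_not] using h.not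

theorem headD {f : α → List β} {g : α → β} (hf : PolyTime A f) (hg : PolyTime A g) :
    PolyTime A fun x => (f x).headD (g x) := by
  refine PolyMap.branch (b := fun x => (f x).isEmpty) hf.isEmpty ?_ ?_
  · convert PolyMap.reindex hg fun i : {i // (f i).isEmpty = true} => i.1 using 3 with i
    simp only [List.isEmpty_iff.1 i.2, List.headD_nil]
  · refine (PolyMap.reindex hf fun i : {i // (f i).isEmpty = false} => i.1).trans ?_
    convert PolyMap.left (A := A)
      (fun i : {i // (f i).isEmpty = false} => toData ((f i).headD (g i)))
      (fun i : {i // (f i).isEmpty = false} => toData (f i).tail) using 2 with i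
    obtain ⟨a, l, h⟩ := List.exists_cons_of_ne_nil (List.isEmpty_eq_false_iff.1 i.2)
    simp [h, toData, listToData]

theorem tail {f : α → List β} (hf : PolyTime A f) : PolyTime A fun x => (f x).tail := by
  refine PolyMap.branch (b := fun x => (f x).isEmpty) hf.isEmpty ?_ ?_
  · convert PolyMap.reindex hf fun i : {i // (f i).isEmpty = true} => i.1 using 3 with i
    simp only [List.isEmpty_iff.1 i.2, List.tail_nil]
  · refine (PolyMap.reindex hf fun i : {i // (f i).isEmpty = false} => i.1).trans ?_
    convert PolyMap.right (A := A)
      (fun i : {i // (f i).isEmpty = false} => ((f i).head?.map toData).getD .leaf)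
      (fun i : {i // (f i).isEmpty = false} => toData (f i).tail) using 2 with i
    obtain ⟨a, l, h⟩ := List.exists_cons_of_ne_nil (List.isEmpty_eq_false_iff.1 i.2)
    simp [h, toData, listToData]

theorem foldl {f : γ → List α} {g : γ → σ} {h : γ → σ → α → σ} (hf : PolyTime A f)
    (hg : PolyTime A g) (hh : PolyTime A fun x : γ × σ × α => h x.1 x.2.1 x.2.2) (B : ℕ[X])
    (hB : ∀ c l, l <+: f c → size (l.foldl (h c) (g c)) ≤ B.eval (size c)) :
    PolyTime A fun c => (f c).foldl (h c) (g c) := by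
  have hinit : PolyMap A (fun c => toData c)
      (fun c => .node (toData (f c)) (.node (toData c) (toData (g c)))) :=
    PolyMap.pair hf (PolyMap.pair id hg)
  refine hinit.trans ((PolyMap.foldl ?_ B hB).trans (PolyMap.right _ _))
  have ha := PolyMap.left (A := A) (fun x : γ × σ × α => toData x.2.2)
    (fun x => .node (toData x.1) (toData x.2.1))
  have hcs := PolyMap.right (A := A) (fun x : γ × σ × α => toData x.2.2)
    (fun x => .node (toData x.1) (toData x.2.1))
  have hc := hcs.trans (PolyMap.left _ _)
  have hs := hcs.trans (PolyMap.right _ _)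
  exact hc.pair ((hc.pair (hs.pair ha)).trans hh)

theorem foldl_of_growth {f : γ → List α} {g : γ → σ} {h : γ → σ → α → σ} (hf : PolyTime A f)
    (hg : PolyTime A g) (hh : PolyTime A fun x : γ × σ × α => h x.1 x.2.1 x.2.2) (B : ℕ[X])
    (hB : ∀ c, ∀ a ∈ f c, ∀ s, size (h c s a) ≤ size s + B.eval (size c)) :
    PolyTime A fun c => (f c).foldl (h c) (g c) := by
  obtain ⟨P, hP⟩ := hf.exists_size_le
  obtain ⟨Q, hQ⟩ := hg.exists_size_le
  refine foldl hf hg hh (Q + P * B) fun c l hl => ?_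
  have hlength : l.length ≤ P.eval (size c) :=
    hl.length_le.trans ((length_lt_size _).le.trans (hP c))
  rw [eval_add, eval_mul]
  calc size (l.foldl (h c) (g c))
    _ ≤ size (g c) + l.length * B.eval (size c) :=
      size_foldl_le l (g c) fun a ha => hB c a (hl.subset ha)
    _ ≤ Q.eval (size c) + P.eval (size c) * B.eval (size c) := by
      gcongr
      exact hQ c

theorem reverse_append {f g : γ → List α} (hf : PolyTime A f) (hg : PolyTime A g) :
    PolyTime A fun c => (f c).reverse ++ g c := by
  obtain ⟨P, hP⟩ := hf.exists_size_le
  have h := foldl_of_growth (h := fun _ s a => a :: s) hf hg (id.snd.snd.cons id.snd.fst) P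
    fun c a ha s => by
      have := size_le_of_mem ha
      have := hP c
      rw [size_cons]; omega
  simpa only [List.foldl_flip_cons_eq_append'] using h

theorem reverse {f : γ → List α} (hf : PolyTime A f) : PolyTime A fun c => (f c).reverse := by
  simpa only [List.append_nil] using hf.reverse_append (const [])

theorem append {f g : γ → List α} (hf : PolyTime A f) (hg : PolyTime A g) :
    PolyTime A fun c => f c ++ g c := by
  simpa only [List.reverse_reverse] using hf.reverse.reverse_append hg

theorem flatMap {f : γ → List α} {g : γ → α → List β} (hf : PolyTime A f)
    (hg : PolyTime A fun x : γ × α => g x.1 x.2) :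
    PolyTime A fun c => (f c).flatMap (g c) := by
  obtain ⟨P, hP⟩ := hf.exists_size_le
  obtain ⟨Q, hQ⟩ := hg.exists_size_le
  have h := foldl_of_growth (h := fun c (s : List β) a => s ++ g c a) (g := fun _ => [])
    hf (const []) (id.snd.fst.append (hg.comp (id.fst.pair id.snd.snd)))
    (Q.comp (X + P + 1)) fun c a ha s => by
      have harg : size (c, a) ≤ size c + P.eval (size c) + 1 := by
        have := size_le_of_mem ha
        have := hP c
        rw [size_mk]; omega
      have hvalue := (hQ (c, a)).trans (polynomial_eval_mono Q harg)
      have happend := size_append s (g c a)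
      simp only [eval_comp, eval_add, eval_X, eval_one] at hvalue ⊢
      omega
  simpa only [← List.flatMap_eq_foldl] using h

theorem map {f : γ → List α} {g : γ → α → β} (hf : PolyTime A f)
    (hg : PolyTime A fun x : γ × α => g x.1 x.2) : PolyTime A fun c => (f c).map (g c) := by
  simpa only [List.map_eq_flatMap] using flatMap (g := fun c a => [g c a]) hf (hg.cons (const []))

theorem filter {f : γ → List α} {p : γ → α → Bool} (hf : PolyTime A f)
    (hp : PolyTime A fun x : γ × α => p x.1 x.2) : PolyTime A fun c => (f c).filter (p c) := by
  convert flatMap (g := fun c a => if p c a = true then [a] else []) hf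
    (hp.ite (id.snd.cons (const [])) (const [])) using 2 with c
  induction f c with
  | nil => rfl
  | cons a l ih => cases h : p c a <;> simp [h, ih]

theorem flatten {f : γ → List (List α)} (hf : PolyTime A f) :
    PolyTime A fun c => (f c).flatten := by
  simpa only [List.flatMap_id'] using flatMap (g := fun _ a => a) hf id.snd

theorem any {f : γ → List α} {p : γ → α → Bool} (hf : PolyTime A f)
    (hp : PolyTime A fun x : γ × α => p x.1 x.2) : PolyTime A fun c => (f c).any (p c) := by
  convert (hf.filter hp).isEmpty.not using 2 with c
  rw [Bool.eq_iff_iff]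
  simp

theorem all {f : γ → List α} {p : γ → α → Bool} (hf : PolyTime A f)
    (hp : PolyTime A fun x : γ × α => p x.1 x.2) : PolyTime A fun c => (f c).all (p c) := by
  simpa only [List.not_any_eq_all_not, Bool.not_not] using
    (any (p := fun c a => !p c a) hf hp.not).not

theorem take_length {f : γ → List ν} {g : γ → List α} (hf : PolyTime A f) (hg : PolyTime A g) :
    PolyTime A fun c => (g c).take (f c).length := by
  obtain ⟨P, hP⟩ := hg.exists_size_le
  have h := (foldl_of_growth (h := fun _ (s : List ν × List α) a =>
      if s.1.isEmpty = true then s else (s.1.tail, s.2 ++ [a])) (g := fun c => (f c, []))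
    hg (hf.pair (const [])) (id.snd.fst.fst.isEmpty.ite id.snd.fst
      (id.snd.fst.fst.tail.pair (id.snd.fst.snd.append (id.snd.snd.cons (const [])))))
    P fun c a ha s => by
      have helem := (size_le_of_mem ha).trans_le (hP c)
      have htail := size_tail_le s.1
      have happend := size_append s.2 [a]
      rw [size_cons, size_nil] at happend
      split_ifs
      · omega
      · rw [size_mk, show size s = size s.1 + size s.2 + 1 from size_mk s.1 s.2]; omega).snd
  simpa only [foldl_snd_eq_append_take, List.nil_append] using h

theorem list_eq [DecidableEq α] (h : PolyTime A fun x : α × α => decide (x.1 = x.2))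
    {f g : γ → List α} (hf : PolyTime A f) (hg : PolyTime A g) :
    PolyTime A fun c => decide (f c = g c) := by
  have hstep : PolyTime A fun x : γ × (List α × Bool) × α => compareStep x.2.1 x.2.2 :=
    id.snd.fst.fst.tail.pair (id.snd.fst.snd.and (id.snd.fst.fst.isEmpty.not.and
      (h.comp (id.snd.snd.pair (id.snd.fst.fst.headD id.snd.snd)))))
  have hfold : PolyTime A fun c => (f c).foldl compareStep (g c, true) :=
    foldl_of_growth (h := fun _ => compareStep) (g := fun c => (g c, true)) hf
      (hg.pair (const true)) hstep 3 fun c a _ s => by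
        have hbool := size_bool_le (compareStep s a).2
        have htail := size_tail_le s.1
        rw [show size (compareStep s a) = size s.1.tail + size (compareStep s a).2 + 1 from
          size_mk _ _, show size s = size s.1 + size s.2 + 1 from size_mk s.1 s.2, eval_ofNat]
        omega
  simpa only [foldl_compareStep, Bool.true_and] using hfold.snd.and hfold.fst.isEmpty

theorem mem [DecidableEq α] (h : PolyTime A fun x : α × α => decide (x.1 = x.2))
    {f : γ → α} {g : γ → List α} (hf : PolyTime A f) (hg : PolyTime A g) :
    PolyTime A fun c => decide (f c ∈ g c) := by
  convert any (p := fun c a => decide (f c = a)) hg (h.comp₂ (g := fun x y => decide (x = y))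
    (hf.comp id.fst) id.snd) using 2 with c
  rw [Bool.eq_iff_iff]
  simp

end PolyTime

end StackProgram

/-! ### Polynomial time functions and Turing machines -/

namespace StackProgram

open Polynomial Coded Prog
open Function (update)

variable {A : Type}

namespace Prog

/-- The last attempt to read an input symbol was successful. -/
def hasSymbol (v : Register A) : Bool := v.1.isSome

/-- Record an input symbol in the register. -/
def readSymbol (v : Register A) (a : Option A) : Register A := (a, v.2)

/-- Move the input to the stack `reversed`. -/
def reverseInput [Inhabited A] : Program A :=
  forEach .input readSymbol hasSymbol (.push .reversed fun v => (v.1.getD default : A))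

/-- Push the word `c a` onto the main stack, where `a` is the symbol in the register, provided that
it occurs in the list. -/
def pushCode [DecidableEq A] (c : A → List Bool) : List A → Program A
  | [] => .load id
  | a :: l => .ite (fun v => v.1 == some a) (pushWord (c a)) (pushCode c l)

/-- Turn the content of the stack `reversed` into a tree on the main stack that represents the list
of symbols, where the word `c a` represents the symbol `a` of the list `l`. -/
def readInput [DecidableEq A] (c : A → List Bool) (l : List A) : Program A :=
  .seq (pushBit false) <|
    forEach .reversed readSymbol hasSymbol (.seq (pushCode c l) (pushBit true))

/-- Move a truth value from the main stack to the output. -/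
def writeOutput : Program A :=
  test (.seq popBit (.seq popBit (.push .output fun _ => true))) (.push .output fun _ => false)

theorem runs_reverseInput [Inhabited A] (l : List A) :
    Runs reverseInput ({ input := l } : Config A).contents
      ({ reversed := l.reverse } : Config A).contents (3 * l.length + 2) := by
  let F (d x : List A) : Config A := { input := x, reversed := d }
  have hstep (d : List A) (y : A) (x : List A) (v : Register A) :
      Exec (.push .reversed fun v => (v.1.getD default : A)) (readSymbol v (some y))
        (update (F d (y :: x)).contents .input x) (readSymbol v (some y))
        (F (y :: d) x).contents 1 := by
    rw [Config.update_input]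
    exact (F d x).update_reversed (y :: d) ▸ .push
  have h : Runs reverseInput (F [] l).contents (F (l.reverse ++ []) []).contents
      ((1 + 2) * l.length + 2) :=
    runs_forEach (Γ := Alphabet A) (k := .input) (F := fun d x => (F d x).contents)
      (fun _ => rfl) (fun _ _ => rfl) (fun _ _ => rfl) (fun d y x v => ⟨_, hstep d y x v⟩) [] l
  rw [List.append_nil] at h
  exact h

theorem exec_pushCode [DecidableEq A] (c : A → List Bool) (C : Config A) (v : Register A) {x : A}
    (hv : v.1 = some x) : ∀ {l : List A}, x ∈ l →
      Exec (pushCode c l) v C.contents v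
        { C with data := update C.data .main (c x ++ C.data .main) }.contents
        ((c x).length + 1 + l.length)
  | y :: l, hx => by
    rcases eq_or_ne x y with rfl | hxy
    · exact (Exec.ite_true (by simp [hv]) (exec_pushWord C v (c x))).mono (by simp)
    · have hxl := (List.mem_cons.1 hx).resolve_left hxy
      exact (Exec.ite_false (by simp [hv, hxy]) (exec_pushCode c C v hv hxl)).mono
        (by simp [add_assoc])

theorem runs_readInput [Fintype A] [DecidableEq A] [Coded A] {K : ℕ} (hK : ∀ x : A, size x ≤ K)
    (l : List A) :
    Runs (readInput (fun x : A => (toData x).word) Finset.univ.toList)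
      ({ reversed := l.reverse } : Config A).contents (mainStack (toData l).word)
      ((K + Fintype.card A + 4) * l.length + 3) := by
  let F (d x : List A) : Config A := { reversed := x, data := triple (toData d).word [] [] }
  have hstep (d : List A) (y : A) (x : List A) (v : Register A) :
      Exec (.seq (pushCode (fun x : A => (toData x).word) Finset.univ.toList) (pushBit true))
        (readSymbol v (some y)) (update (F d (y :: x)).contents .reversed x)
        (readSymbol v (some y)) (F (y :: d) x).contents (K + Fintype.card A + 2) := by
    rw [Config.update_reversed]
    have hcode := exec_pushCode (fun x : A => (toData x).word) (F d x) (readSymbol v (some y)) rfl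
      (Finset.mem_toList.2 (Finset.mem_univ y))
    have hbit := exec_push_data { F d x with
      data := triple ((toData y).word ++ (toData d).word) [] [] }
      (readSymbol v (some y)) (fun _ => true) .main
    have hlength : (toData y).word.length ≤ K := hK y
    rw [update_triple_main] at hcode hbit
    exact (hcode.seq hbit).mono (by rw [Finset.length_toList, Finset.card_univ]; omega)
  have hinit : Runs (pushBit false) ({ reversed := l.reverse } : Config A).contents
      (F [] l.reverse).contents 1 := fun v => ⟨v, by
    have h := exec_push_data (A := A) { reversed := l.reverse, data := triple [] [] [] } v
      (fun _ => false) .main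
    rw [update_triple_main, triple_nil] at h
    exact h⟩
  have hloop : Runs (forEach .reversed readSymbol hasSymbol <|
        .seq (pushCode (fun x : A => (toData x).word) Finset.univ.toList) (pushBit true))
      (F [] l.reverse).contents (F (l.reverse.reverse ++ []) []).contents
      ((K + Fintype.card A + 2 + 2) * l.reverse.length + 2) :=
    runs_forEach (Γ := Alphabet A) (k := .reversed) (F := fun d x => (F d x).contents)
      (fun _ => rfl) (fun _ _ => rfl) (fun _ _ => rfl) (fun d y x v => ⟨_, hstep d y x v⟩)
      [] l.reverse
  rw [List.append_nil, List.reverse_reverse, List.length_reverse] at hloop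
  exact (hinit.seq hloop).mono (by linarith)

theorem runs_writeOutput (y : Bool) :
    Runs (writeOutput : Program A) (mainStack (toData y).word)
      ({ output := [y] } : Config A).contents 6 := by
  have hpush : Runs (.push .output fun _ => y : Program A) (mainStack [])
      ({ output := [y] } : Config A).contents 1 := fun v => ⟨v, by
    rw [mainStack, triple_nil]
    exact Config.update_output (A := A) {} [y] ▸ .push⟩
  cases y with
  | false => exact (runs_test_false hpush).mono (t₂ := 6) (by omega)
  | true =>
    exact (runs_test_true ((runs_popBit false).seq ((runs_popBit false).seq hpush))).mono
      (t₂ := 6) (by omega)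

end Prog

/-- The Turing machine that runs a program and clears the register at the end. -/
def machine [Fintype A] (p : Program A) : Turing.FinTM2 where
  K := Stack
  k₀ := .input
  k₁ := .output
  Γ := Alphabet A
  Λ := Option p.Label
  main := some p.entry
  σ := Register A
  initialState := (none, none)
  Γk₀Fin := inferInstanceAs (Fintype A)
  m
    | some l => p.code some none l
    | none => .load (fun _ => (none, none)) .halt

theorem initList_machine [Fintype A] (p : Program A) (l : List A) :
    Turing.initList (machine p) l =
      ⟨some (some p.entry), (none, none), ({ input := l } : Config A).contents⟩ := by
  unfold Turing.initList
  congr 1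
  funext k
  cases k <;> rfl

theorem haltList_machine [Fintype A] (p : Program A) (o : List Bool) :
    Turing.haltList (machine p) o =
      ⟨none, (none, none), ({ output := o } : Config A).contents⟩ := by
  unfold Turing.haltList
  congr 1
  funext k
  cases k <;> rfl

theorem machine_outputs [Fintype A] {p : Program A} {l : List A} {o : List Bool} {t : ℕ}
    (h : Runs p ({ input := l } : Config A).contents ({ output := o } : Config A).contents t) :
    Nonempty (Turing.TM2OutputsInTime (machine p) l (some o) (t + 1)) := by
  obtain ⟨v, h⟩ := h (none, none)
  have hrun := (h.reachesIn (machine p).m some none fun _ => rfl).trans (.single rfl)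
  change Nonempty (StateTransition.EvalsToInTime (machine p).step (Turing.initList (machine p) l)
    (some (Turing.haltList (machine p) o)) (t + 1))
  rw [initList_machine, haltList_machine]
  exact hrun

/-- Decide whether the computation of `p` on the input word yields `true`. -/
noncomputable def decider [Fintype A] [DecidableEq A] [Inhabited A] [Coded A] (p : Program A) :
    Program A :=
  .seq reverseInput <| .seq (readInput (fun x : A => (toData x).word) Finset.univ.toList) <|
    .seq p writeOutput

theorem size_list_le [Coded A] {K : ℕ} (hK : ∀ x : A, size x ≤ K) (l : List A) :
    size l ≤ l.length * (K + 1) + 1 := by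
  induction l with
  | nil => simp
  | cons x l ih =>
    have hx := hK x
    simp only [size_cons, List.length_cons, Nat.add_mul] at ih ⊢
    omega

theorem exists_runs_decider [Fintype A] [DecidableEq A] [Inhabited A] [Coded A] {p : Program A}
    {P : ℕ[X]} {f : List A → Bool} (hp : ∀ l, Transforms p P (toData l) (toData (f l))) :
    ∃ Q : ℕ[X], ∀ l, Runs (decider p) ({ input := l } : Config A).contents
      ({ output := [f l] } : Config A).contents (Q.eval l.length) := by
  obtain ⟨K, hK⟩ : ∃ K, ∀ x : A, size x ≤ K :=
    ⟨Finset.univ.sup size, fun x => Finset.le_sup (Finset.mem_univ x)⟩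
  refine ⟨(3 * X + 2) + ((C (K + Fintype.card A + 4) * X + 3) +
    (P.comp (X * C (K + 1) + 1) + 6)), fun l => ?_⟩
  have hrun := (hp l).2 []
  rw [List.append_nil, List.append_nil] at hrun
  simp only [eval_add, eval_mul, eval_X, eval_C, eval_comp, eval_ofNat, eval_one]
  exact (runs_reverseInput l).seq <| (runs_readInput hK l).seq <|
    (hrun.mono (polynomial_eval_mono P (size_list_le hK l))).seq (runs_writeOutput (f l))

theorem PolyTime.inP [Fintype A] [Inhabited A] [Coded A] {α : Type}
    {e : Computability.Encoding α A} {S : Set α} {f : List A → Bool} (hf : PolyTime A f)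
    (h : ∀ x, f (e.encode x) = true ↔ x ∈ S) : DefaultLogic.InP e S := by
  classical
  obtain ⟨p, P, hp⟩ := hf
  obtain ⟨Q, hQ⟩ := exists_runs_decider hp
  refine ⟨⟨⟨machine (decider p), Equiv.refl _, Equiv.refl _⟩, Q + 1, fun x => ?_⟩⟩
  have hx : decide (x ∈ S) = f (e.encode x) := by
    rw [Bool.eq_iff_iff, h x, decide_eq_true_iff]
  rw [hx, eval_add, eval_one]
  exact Classical.choice (machine_outputs ((List.map_id _).symm ▸ hQ (e.encode x)))

end StackProgram

/-! ### Strong backdoors into ID -/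

namespace DefaultLogic

section

variable {V : Type}

theorem Literal.holds_compl (w : V → Bool) (l : Literal V) :
    l.compl.Holds w ↔ ¬ l.Holds w := by
  cases l <;> simp [Literal.compl, Literal.Holds]

theorem subset_Th (S : Set (CNF V)) : S ⊆ Th S := fun _ hφ _ hv => hv _ hφ

theorem Th_Th (S : Set (CNF V)) : Th (Th S) = Th S :=
  Set.Subset.antisymm (fun _ hφ v hv => hφ v fun _ hψ => hψ v hv) (subset_Th _)

theorem Th_mono {S S' : Set (CNF V)} (h : S ⊆ S') : Th S ⊆ Th S' :=
  fun _ hφ v hv => hφ v fun _ hψ => hv _ (h hψ)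

theorem mem_Th_singleton {φ ψ : CNF V} :
    ψ ∈ Th {φ} ↔ ∀ w, CNF.Sat w φ → CNF.Sat w ψ := by
  simp [Th, Entails]

theorem sat_insert [DecidableEq V] (w : V → Bool) (C : Clause V) (φ : CNF V) :
    CNF.Sat w (insert C φ) ↔ (∃ l ∈ C, Literal.Holds w l) ∧ CNF.Sat w φ :=
  Finset.forall_mem_insert ..

/-- The negation of a clause `C` is a conjunction of literals, and distributing it over the clauses
of a negation of `β` yields a negation of `insert C β`. -/
theorem exists_isNegationOf (β : CNF V) : ∃ ψ, IsNegationOf ψ β := by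
  classical
  induction β using Finset.induction_on with
  | empty => exact ⟨CNF.bot, fun w => by simp [CNF.Sat, CNF.bot]⟩
  | insert C β _ ih =>
    obtain ⟨ψ, hψ⟩ := ih
    refine ⟨(C ×ˢ ψ).image fun p => insert p.1.compl p.2, fun w => ?_⟩
    rw [sat_insert, not_and_or, ← hψ w]
    simp only [CNF.Sat, Finset.mem_image, Finset.mem_product, Prod.exists, forall_exists_index,
      and_imp]
    constructor
    · intro h
      by_contra! hcon
      obtain ⟨⟨l, hl, hlw⟩, D, hD, hDw⟩ := hcon
      obtain ⟨l', hl', hw⟩ := h _ l D hl hD rfl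
      rcases Finset.mem_insert.1 hl' with rfl | hl'
      · exact (l.holds_compl w).1 hw hlw
      · exact hDw l' hl' hw
    · rintro (h | h) _ l D hl hD rfl
      · exact ⟨l.compl, Finset.mem_insert_self .., (l.holds_compl w).2 fun hlw => h ⟨l, hl, hlw⟩⟩
      · obtain ⟨l', hl', hw⟩ := h D hD
        exact ⟨l', Finset.mem_insert_of_mem hl', hw⟩

theorem negMem_Th_iff (S : Set (CNF V)) (β : CNF V) :
    NegMem β (Th S) ↔ ∀ w, (∀ φ ∈ S, CNF.Sat w φ) → ¬ CNF.Sat w β := by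
  constructor
  · rintro ⟨ψ, hψS, hψ⟩ w hw
    exact (hψ w).1 (hψS w hw)
  · intro h
    obtain ⟨ψ, hψ⟩ := exists_isNegationOf β
    exact ⟨ψ, fun w hw => (hψ w).2 (h w hw), hψ⟩

theorem forall_sat_iff_of_Th_eq {S S' : Set (CNF V)} (h : Th S = Th S') (w : V → Bool) :
    (∀ φ ∈ S, CNF.Sat w φ) ↔ ∀ φ ∈ S', CNF.Sat w φ :=
  ⟨fun hw _ hφ => (h ▸ subset_Th S' hφ : _ ∈ Th S) w hw,
    fun hw _ hφ => (h ▸ subset_Th S hφ : _ ∈ Th S') w hw⟩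

namespace DefaultTheory

/-- The knowledge base and the conclusions of the generating defaults of `E`, that is, of the rules
whose prerequisite belongs to `E` and whose justification is consistent with `E`. -/
def generators (T : DefaultTheory V) (E : Set (CNF V)) : Set (CNF V) :=
  {φ | φ ∈ T.W ∨ ∃ δ ∈ T.D, δ.prereq ∈ E ∧ ¬ NegMem δ.just E ∧ φ = δ.concl}

theorem IsStableExtension.gammaClosed {T : DefaultTheory V} {E : Set (CNF V)}
    (hE : T.IsStableExtension E) : T.GammaClosed E E := by
  have h : T.GammaClosed E (T.Gamma E) := (T.gamma_isLeast E).1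
  rwa [← hE] at h

theorem IsStableExtension.eq_Th_generators {T : DefaultTheory V} {E : Set (CNF V)}
    (hE : T.IsStableExtension E) : E = Th (T.generators E) := by
  have hclosed := hE.gammaClosed
  have hsub : Th (T.generators E) ⊆ E := by
    refine (Th_mono ?_).trans hclosed.closed.ge
    rintro φ (hφ | ⟨δ, hδ, hp, hj, rfl⟩)
    · exact hclosed.base φ hφ
    · exact hclosed.rules δ hδ hp hj
  refine Set.Subset.antisymm ?_ hsub
  conv_lhs => rw [hE]
  exact (T.gamma_isLeast E).2 ⟨fun φ hφ => subset_Th _ (.inl hφ), (Th_Th _).symm,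
    fun δ hδ hp hj => subset_Th _ (.inr ⟨δ, hδ, hsub hp, hj, rfl⟩)⟩

end DefaultTheory

/-- Outside `B`, every clause has at most one literal, and this literal is positive. This is what
it means for `B` to be a strong backdoor into the class ID. -/
def CNF.IsPositiveUnitOutside (B : Finset V) (φ : CNF V) : Prop :=
  ∀ C ∈ φ, ∀ l ∈ C, l.var ∉ B → (∃ x, l = .pos x) ∧ ∀ l' ∈ C, l'.var ∉ B → l' = l

theorem Literal.map_injective {U : Type} {f : V → U} (hf : Function.Injective f) :
    Function.Injective (Literal.map f) := by
  rintro (x | x) (y | y) h <;> simp only [Literal.map, Literal.pos.injEq, Literal.neg.injEq,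
    reduceCtorEq] at h
  · rw [hf h]
  · rw [hf h]

theorem rename_mem_classID {U : Type} [DecidableEq U] {f : V → U} (hf : Function.Injective f)
    (φ : CNF V) : CNF.rename f φ ∈ classID U ↔ φ ∈ classID V := by
  simp only [classID, CNF.rename, Set.mem_ofPred_eq, Finset.forall_mem_image]
  refine forall₂_congr fun C _ => or_congr Finset.image_eq_empty ⟨?_, ?_⟩
  · rintro ⟨x, hx⟩
    obtain ⟨l, rfl⟩ : ∃ l, C = {l} := by
      rw [← Finset.card_eq_one, ← Finset.card_image_of_injective C (Literal.map_injective hf), hx,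
        Finset.card_singleton]
    cases l with
    | pos y => exact ⟨y, rfl⟩
    | neg y => simp [Literal.map] at hx
  · rintro ⟨x, rfl⟩
    exact ⟨f x, by simp [Literal.map]⟩

/-- All formulas of the theory satisfy `p`. -/
def DefaultTheory.Forall (T : DefaultTheory V) (p : CNF V → Prop) : Prop :=
  (∀ φ ∈ T.W, p φ) ∧ ∀ δ ∈ T.D, p δ.prereq ∧ p δ.just ∧ p δ.concl

theorem DefaultTheory.Forall.imp {T : DefaultTheory V} {p q : CNF V → Prop} (h : T.Forall p)
    (hpq : ∀ φ, p φ → q φ) : T.Forall q :=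
  ⟨fun φ hφ => hpq φ (h.1 φ hφ), fun δ hδ =>
    ⟨hpq _ (h.2 δ hδ).1, hpq _ (h.2 δ hδ).2.1, hpq _ (h.2 δ hδ).2.2⟩⟩

theorem DefaultTheory.Forall.of_mem_generators {T : DefaultTheory V} {p : CNF V → Prop}
    (h : T.Forall p) {E : Set (CNF V)} {φ : CNF V} (hφ : φ ∈ T.generators E) : p φ := by
  rcases hφ with hφ | ⟨δ, hδ, -, -, rfl⟩
  · exact h.1 φ hφ
  · exact (h.2 δ hδ).2.2

variable [DecidableEq V]

theorem reducts_eps (l : List V) : ∀ φ : CNF V, CNF.reducts φ (l.map .eps) =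
    φ.image fun C => C.filter fun t => t.var ∉ l := by
  induction l with
  | nil => intro φ; simp [CNF.reducts]
  | cons x l ih =>
    intro φ
    have h := ih (φ.reduct (.eps x))
    simp only [CNF.reducts, List.map_cons, List.foldl_cons] at h ⊢
    rw [h, CNF.reduct, Finset.image_image]
    congr 1
    funext C
    ext t
    have ht : t.var = x ↔ t = .pos x ∨ t = .neg x := by cases t <;> simp [Literal.var]
    simp only [Function.comp, Finset.mem_filter, Finset.mem_erase, List.mem_cons, ht]
    tauto

theorem mem_reduct {φ : CNF V} {y : ExtLiteral V} {C' : Clause V} (h : C' ∈ φ.reduct y) :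
    ∃ C ∈ φ, C' ⊆ C ∧ ∀ l ∈ C', l.var ≠ y.var := by
  cases y with
  | lit t =>
    simp only [CNF.reduct, Finset.mem_image, Finset.mem_filter] at h
    obtain ⟨C, ⟨hC, ht⟩, rfl⟩ := h
    refine ⟨C, hC, Finset.erase_subset _ _, fun l hl hv => ?_⟩
    obtain ⟨h₁, h₂⟩ := Finset.mem_erase.1 hl
    cases l <;> cases t <;> simp_all [Literal.var, Literal.compl, ExtLiteral.var]
  | eps x =>
    simp only [CNF.reduct, Finset.mem_image] at h
    obtain ⟨C, hC, rfl⟩ := h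
    refine ⟨C, hC, (Finset.erase_subset _ _).trans (Finset.erase_subset _ _), fun l hl hv => ?_⟩
    cases l <;> simp_all [Literal.var, ExtLiteral.var]

theorem mem_reducts (Y : List (ExtLiteral V)) : ∀ {φ : CNF V} {C' : Clause V},
    C' ∈ φ.reducts Y → ∃ C ∈ φ, C' ⊆ C ∧ ∀ l ∈ C', l.var ∉ Y.map ExtLiteral.var := by
  induction Y with
  | nil => exact fun {φ C'} h => ⟨C', h, subset_rfl, by simp⟩
  | cons y Y ih =>
    intro φ C' h
    obtain ⟨C₁, hC₁, hsub₁, hv₁⟩ := ih (φ := φ.reduct y) h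
    obtain ⟨C, hC, hsub, hv⟩ := mem_reduct hC₁
    refine ⟨C, hC, hsub₁.trans hsub, fun l hl => ?_⟩
    rw [List.map_cons, List.mem_cons, not_or]
    exact ⟨hv l (hsub₁ hl), hv₁ l hl⟩

theorem CNF.IsPositiveUnitOutside.reducts_mem {B : Finset V} {φ : CNF V}
    (h : φ.IsPositiveUnitOutside B) {Y : List (ExtLiteral V)} (hY : IsThreefoldAssignment B Y) :
    φ.reducts Y ∈ classID V := by
  intro C' hC'
  obtain ⟨C, hC, hsub, hv⟩ := mem_reducts Y hC'
  have hB : ∀ l ∈ C', l.var ∉ B := fun l hl => by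
    rw [← hY.2, List.mem_toFinset]; exact hv l hl
  rcases C'.eq_empty_or_nonempty with h' | ⟨l, hl⟩
  · exact .inl h'
  · obtain ⟨⟨x, rfl⟩, huniq⟩ := h C hC l (hsub hl) (hB l hl)
    exact .inr ⟨x, Finset.eq_singleton_iff_unique_mem.2
      ⟨hl, fun l' hl' => huniq l' (hsub hl') (hB l' hl')⟩⟩

theorem isPositiveUnitOutside_of_reducts {B : Finset V} {φ : CNF V}
    (h : φ.reducts (B.toList.map .eps) ∈ classID V) : φ.IsPositiveUnitOutside B := by
  rw [reducts_eps] at h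
  intro C hC l hl hlB
  have hmem : ∀ l ∈ C, l.var ∉ B → l ∈ C.filter fun t => t.var ∉ B.toList := fun l hl h => by
    simpa using ⟨hl, h⟩
  rcases h _ (Finset.mem_image_of_mem _ hC) with h | ⟨x, hx⟩
  · have := hmem l hl hlB
    simp only [h, Finset.notMem_empty] at this
  · simp only [hx, Finset.mem_singleton] at hmem
    exact ⟨⟨x, hmem l hl hlB⟩, fun l' hl' h' => (hmem l' hl' h').trans (hmem l hl hlB).symm⟩

theorem isThreefoldAssignment_eps (B : Finset V) :
    IsThreefoldAssignment B (B.toList.map .eps) := by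
  have : (B.toList.map .eps).map ExtLiteral.var = B.toList := by
    simp [List.map_map, Function.comp_def, ExtLiteral.var]
  exact ⟨by rw [this]; exact B.nodup_toList, by rw [this]; exact B.toList_toFinset⟩

theorem union_mem_classID {φ ψ : CNF V} :
    φ ∪ ψ ∈ classID V ↔ φ ∈ classID V ∧ ψ ∈ classID V := by
  simp [classID, Finset.mem_union, or_imp, forall_and]

theorem reducts_inClass_iff (T : DefaultTheory V) (Y : List (ExtLiteral V)) :
    (T.reducts Y).InClass classID ↔ T.Forall fun φ => φ.reducts Y ∈ classID V := by
  have hy : ∀ δ : Default V, ({{Literal.pos (Sum.inr δ)}} : CNF (V ⊕ Default V)) ∈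
      classID (V ⊕ Default V) := fun δ C hC => .inr ⟨_, Finset.mem_singleton.1 hC⟩
  unfold DefaultTheory.InClass DefaultTheory.Forall DefaultTheory.reducts
  simp only [Finset.mem_singleton, forall_eq, Finset.forall_mem_image, union_mem_classID,
    rename_mem_classID Sum.inl_injective, hy, and_true]
  refine and_congr ?_ Iff.rfl
  simp only [classID, Set.mem_ofPred_eq, Finset.mem_biUnion]
  exact ⟨fun h φ hφ C hC => h C ⟨φ, hφ, hC⟩, fun h C ⟨φ, hφ, hC⟩ => h φ hφ C hC⟩

theorem isStrongBackdoor_classID_iff (T : DefaultTheory V) (B : Finset V) :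
    T.IsStrongBackdoor classID B ↔
      B ⊆ T.vars ∧ T.Forall fun φ => φ.IsPositiveUnitOutside B := by
  unfold DefaultTheory.IsStrongBackdoor
  exact and_congr Iff.rfl ⟨
    fun h => ((reducts_inClass_iff T _).1 (h _ (isThreefoldAssignment_eps B))).imp
      fun _ => isPositiveUnitOutside_of_reducts,
    fun h Y hY => (reducts_inClass_iff T Y).2 (h.imp fun _ hφ => hφ.reducts_mem hY)⟩

end

end DefaultLogic

/-! ### Evaluation by guessing the consistent assignments of the backdoor variables -/

namespace DefaultLogic

/-- The truth value of a literal. -/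
def Literal.eval {V : Type} (w : V → Bool) : Literal V → Bool
  | pos x => w x
  | neg x => !w x

theorem Literal.eval_eq_true {V : Type} (w : V → Bool) (l : Literal V) :
    l.eval w = true ↔ l.Holds w := by
  cases l <;> simp [Literal.eval, Literal.Holds]

/-- The assignment under which exactly the variables in the list `v` are true. Lists of variables
represent the assignments of the backdoor variables. -/
def assignment (v : List Var) (x : Var) : Bool := decide (x ∈ v)

/-- On `B`, the assignment `w` is given by `v`. -/
def Agrees (B v : List Var) (w : Var → Bool) : Prop := ∀ x ∈ B, w x = assignment v x

/-- The greatest assignment that is given by `v ⊆ B` on `B`. -/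
def greatest (B v : List Var) (x : Var) : Bool := assignment v x || !decide (x ∈ B)

/-- The list `L` represents all assignments of the variables in `B`. -/
structure Covers (B : List Var) (L : List (List Var)) : Prop where
  subset : ∀ v ∈ L, v ⊆ B
  exists_agrees : ∀ w : Var → Bool, ∃ v ∈ L, Agrees B v w

section

variable {B v : List Var} {w w' : Var → Bool}

theorem Agrees.holds_iff (h : Agrees B v w) (h' : Agrees B v w') {l : Literal Var}
    (hl : l.var ∈ B) : l.Holds w ↔ l.Holds w' := by
  have heq : w l.var = w' l.var := (h _ hl).trans (h' _ hl).symm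
  cases l <;> simp only [Literal.Holds, Literal.var] at heq ⊢ <;> rw [heq]

theorem agrees_greatest : Agrees B v (greatest B v) := fun x hx => by simp [greatest, hx]

theorem CNF.IsPositiveUnitOutside.sat_greatest {φ : CNF Var}
    (hφ : φ.IsPositiveUnitOutside B.toFinset) (hw : Agrees B v w) (h : CNF.Sat w φ) :
    CNF.Sat (greatest B v) φ := by
  intro C hC
  obtain ⟨l, hl, hlw⟩ := h C hC
  refine ⟨l, hl, ?_⟩
  by_cases hB : l.var ∈ B
  · exact (hw.holds_iff agrees_greatest hB).1 hlw
  · obtain ⟨⟨x, rfl⟩, -⟩ := hφ C hC l hl (by rwa [List.mem_toFinset])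
    have hx : x ∉ B := hB
    simp [Literal.Holds, greatest, hx]

end

namespace RawCNF

/-- The truth value of a clause. -/
def evalClause (w : Var → Bool) (C : List (Literal Var)) : Bool := C.any fun l => l.eval w

/-- The truth value of a formula. -/
def eval (w : Var → Bool) (r : RawCNF) : Bool := List.all r (evalClause w)

theorem evalClause_eq_true (w : Var → Bool) (C : List (Literal Var)) :
    evalClause w C = true ↔ ∃ l ∈ C, l.Holds w := by
  simp [evalClause, Literal.eval_eq_true]

theorem eval_eq_true (w : Var → Bool) (r : RawCNF) :
    r.eval w = true ↔ ∀ C ∈ r, ∃ l ∈ C, l.Holds w := by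
  simp [eval, evalClause_eq_true]

theorem sat_toCNF (w : Var → Bool) (r : RawCNF) : CNF.Sat w r.toCNF ↔ r.eval w = true := by
  simp [eval_eq_true, CNF.Sat, toCNF]

/-- Outside `B`, every clause has at most one literal, and this literal is positive. -/
def IsPositiveUnitOutside (B : List Var) (r : RawCNF) : Prop :=
  ∀ C ∈ r, ∀ l ∈ C, l.var ∉ B → (∃ x, l = .pos x) ∧ ∀ l' ∈ C, l'.var ∉ B → l' = l

theorem isPositiveUnitOutside_toCNF (B : List Var) (r : RawCNF) :
    r.toCNF.IsPositiveUnitOutside B.toFinset ↔ r.IsPositiveUnitOutside B := by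
  simp [CNF.IsPositiveUnitOutside, IsPositiveUnitOutside, toCNF]

/-- The least model of `r` among the assignments that are given by `v ⊆ B` on `B`, if there is such
a model: outside `B`, it makes true the literals of the clauses that `v` does not satisfy. -/
def least (B v : List Var) (r : RawCNF) (x : Var) : Bool :=
  assignment v x || (!decide (x ∈ B) && List.any r fun C =>
    !evalClause (assignment v) C && decide (Literal.pos x ∈ C))

variable {B v : List Var} {r α : RawCNF} {w : Var → Bool}

theorem agrees_least : Agrees B v (least B v r) := fun x hx => by simp [least, hx]

theorem least_eq_true {x : Var} (hx : x ∉ B) : least B v r x = true ↔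
    x ∈ v ∨ ∃ C ∈ r, ¬ (∃ l ∈ C, l.Holds (assignment v)) ∧ Literal.pos x ∈ C := by
  simp only [least, assignment, hx, decide_false, Bool.not_false, Bool.true_and, Bool.or_eq_true,
    decide_eq_true_eq, List.any_eq_true, Bool.and_eq_true, Bool.not_eq_true',
    ← evalClause_eq_true, Bool.not_eq_true]

theorem eval_greatest (hr : r.IsPositiveUnitOutside B) (hw : Agrees B v w)
    (h : r.eval w = true) : r.eval (greatest B v) = true := by
  rw [← sat_toCNF] at h ⊢
  exact ((isPositiveUnitOutside_toCNF B r).2 hr).sat_greatest hw h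

theorem eval_least (hv : v ⊆ B) (hr : r.IsPositiveUnitOutside B)
    (h : r.eval (greatest B v) = true) : r.eval (least B v r) = true := by
  rw [eval_eq_true] at h ⊢
  intro C hC
  by_cases hsat : ∃ l ∈ C, l.Holds (assignment v)
  · obtain ⟨l, hl, hlv⟩ := hsat
    refine ⟨l, hl, ?_⟩
    by_cases hB : l.var ∈ B
    · exact (Agrees.holds_iff (fun _ _ => rfl) agrees_least hB).1 hlv
    · obtain ⟨⟨x, rfl⟩, -⟩ := hr C hC l hl hB
      exact absurd (hv (of_decide_eq_true hlv)) hB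
  · obtain ⟨l, hl, hlw⟩ := h C hC
    refine ⟨l, hl, ?_⟩
    by_cases hB : l.var ∈ B
    · exact absurd ⟨l, hl, (agrees_greatest.holds_iff (fun _ _ => rfl) hB).1 hlw⟩ hsat
    · obtain ⟨⟨x, rfl⟩, -⟩ := hr C hC l hl hB
      exact (least_eq_true hB).2 (.inr ⟨C, hC, hsat, hl⟩)

theorem least_le (hv : v ⊆ B) (hr : r.IsPositiveUnitOutside B) (hw : Agrees B v w)
    (h : r.eval w = true) {x : Var} (hx : x ∉ B) (hl : least B v r x = true) : w x = true := by
  rcases (least_eq_true hx).1 hl with hxv | ⟨C, hC, hunsat, hxC⟩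
  · exact absurd (hv hxv) hx
  · obtain ⟨l, hlC, hlw⟩ := (eval_eq_true _ _).1 h C hC
    by_cases hB : l.var ∈ B
    · exact absurd ⟨l, hlC, (hw.holds_iff (fun _ _ => rfl) hB).1 hlw⟩ hunsat
    · rwa [← (hr C hC l hlC hB).2 _ hxC hx] at hlw

theorem eval_of_eval_least (hv : v ⊆ B) (hr : r.IsPositiveUnitOutside B)
    (hα : α.IsPositiveUnitOutside B) (hw : Agrees B v w) (h : r.eval w = true)
    (hl : α.eval (least B v r) = true) : α.eval w = true := by
  rw [eval_eq_true] at hl ⊢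
  intro C hC
  obtain ⟨l, hlC, hlw⟩ := hl C hC
  refine ⟨l, hlC, ?_⟩
  by_cases hB : l.var ∈ B
  · exact (agrees_least.holds_iff hw hB).1 hlw
  · obtain ⟨⟨x, rfl⟩, -⟩ := hα C hC l hlC hB
    exact least_le hv hr hw h hB hlw

/-- A test for `r ⊨ α`, where `L` lists the assignments of the variables in `B`. For each of them,
`r` has a model iff the greatest assignment is a model, and it suffices to evaluate `α` in the
least model. -/
def entails (B : List Var) (L : List (List Var)) (r α : RawCNF) : Bool :=
  L.all fun v => !r.eval (greatest B v) || α.eval (least B v r)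

theorem entails_iff {L : List (List Var)} (hL : Covers B L) (hr : r.IsPositiveUnitOutside B)
    (hα : α.IsPositiveUnitOutside B) :
    entails B L r α = true ↔ ∀ w, r.eval w = true → α.eval w = true := by
  simp only [entails, List.all_eq_true, Bool.or_eq_true, Bool.not_eq_true', ← Bool.not_eq_true,
    ← imp_iff_not_or]
  constructor
  · intro h w hw
    obtain ⟨v, hv, hvw⟩ := hL.exists_agrees w
    exact eval_of_eval_least (hL.subset v hv) hr hα hvw hw (h v hv (eval_greatest hr hvw hw))
  · exact fun h v hv hg => h _ (eval_least (hL.subset v hv) hr hg)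

end RawCNF

theorem iterate_eq_of_sublist {α : Type*} (f : List α → List α) (s : List α)
    (hs : ∀ l, (f l).Sublist s)
    (hf : ∀ l l', l'.Sublist s → l.Sublist l' → (f l).Sublist (f l')) :
    f (f^[s.length] []) = f^[s.length] [] := by
  have hsub : ∀ i, (f^[i] []).Sublist s
    | 0 => List.nil_sublist s
    | i + 1 => by rw [Function.iterate_succ_apply']; exact hs _
  have hstep : ∀ i, (f^[i] []).Sublist (f^[i + 1] []) := by
    intro i
    induction i with
    | zero => exact List.nil_sublist _
    | succ i ih =>
      rw [Function.iterate_succ_apply' f (i + 1), Function.iterate_succ_apply' f i]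
      rw [Function.iterate_succ_apply'] at ih
      exact hf _ _ (hs _) ih
  have hlength : (f^[s.length + 1] []).length = (f^[s.length] []).length :=
    Nat.stabilises_of_monotone (f := fun i => (f^[i] []).length)
      (monotone_nat_of_le_succ fun i => (hstep i).length_le) (fun i => (hsub i).length_le)
      (fun i hi => by
        have hfix : f^[i + 1] [] = f^[i] [] := ((hstep i).eq_of_length hi).symm
        simp only [Function.iterate_succ_apply' f] at hfix ⊢
        rw [hfix, hfix]) (Nat.le_succ _)
  rw [← Function.iterate_succ_apply' f]
  exact ((hstep _).eq_of_length hlength.symm).symm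

/-- A default rule as it is written in the input: prerequisite, justification, conclusion. -/
abbrev RawDefault := RawCNF × RawCNF × RawCNF

namespace RawInstance

open RawCNF

/-- All formulas of the instance satisfy `p`. -/
def Forall (I : RawInstance) (p : RawCNF → Prop) : Prop :=
  (∀ r ∈ I.kb, p r) ∧ ∀ d ∈ I.rules, p d.1 ∧ p d.2.1 ∧ p d.2.2

/-- The knowledge base together with the conclusions of the rules in `l`. -/
def conclusions (I : RawInstance) (l : List RawDefault) : RawCNF :=
  I.kb.flatten ++ l.flatMap fun d => d.2.2

/-- The rule `d` is applicable if its prerequisite follows from `r` and its justification is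
consistent with one of the assignments in `A`, which is a guess of the assignments of the backdoor
variables that are consistent with the extension. -/
def applicable (B : List Var) (L A : List (List Var)) (r : RawCNF) (d : RawDefault) : Bool :=
  entails B L r d.1 && A.any fun v => d.2.1.eval (greatest B v)

/-- The rules that are applicable after the rules `l` have been applied. -/
def applyRules (I : RawInstance) (B : List Var) (L A : List (List Var)) (l : List RawDefault) :
    List RawDefault :=
  I.rules.filter (applicable B L A (I.conclusions l))

/-- The rules that are eventually applied under the guess `A`. -/
def appliedRules (I : RawInstance) (B : List Var) (L A : List (List Var)) : List RawDefault :=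
  I.rules.foldl (fun l _ => I.applyRules B L A l) []

/-- Everything that is derived under the guess `A`. -/
def closure (I : RawInstance) (B : List Var) (L A : List (List Var)) : RawCNF :=
  I.conclusions (I.appliedRules B L A)

/-- The assignments from `L` that are consistent with `r`. -/
def consistentPart (B : List Var) (L : List (List Var)) (r : RawCNF) : List (List Var) :=
  L.filter fun v => r.eval (greatest B v)

/-- The guess `A` is confirmed by what is derived under it. -/
def accepts (I : RawInstance) (B : List Var) (L A : List (List Var)) : Bool :=
  decide (A = consistentPart B L (I.closure B L A))

/-- For the justifications of the instance, consistency with `E` amounts to being satisfied by a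
greatest assignment for some `v ∈ A`. -/
def DecidesJustifications (I : RawInstance) (B : List Var) (A : List (List Var))
    (E : Set (CNF Var)) : Prop :=
  ∀ d ∈ I.rules, NegMem d.2.1.toCNF E ↔ ¬ ∃ v ∈ A, d.2.1.eval (greatest B v) = true

theorem mem_theory_W {I : RawInstance} {φ : CNF Var} :
    φ ∈ I.theory.W ↔ ∃ r ∈ I.kb, r.toCNF = φ := by
  simp [theory]

theorem mem_theory_D {I : RawInstance} {δ : Default Var} :
    δ ∈ I.theory.D ↔ ∃ d ∈ I.rules, ⟨d.1.toCNF, d.2.1.toCNF, d.2.2.toCNF⟩ = δ := by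
  simp only [theory, List.mem_toFinset, List.mem_map]

theorem theory_forall (I : RawInstance) (p : CNF Var → Prop) :
    I.theory.Forall p ↔ I.Forall fun r => p r.toCNF := by
  simp only [DefaultTheory.Forall, Forall, theory, List.mem_toFinset, List.forall_mem_map]

theorem theory_forall_isPositiveUnitOutside (I : RawInstance) (B : List Var) :
    I.theory.Forall (·.IsPositiveUnitOutside B.toFinset) ↔
      I.Forall (·.IsPositiveUnitOutside B) := by
  simp only [theory_forall, isPositiveUnitOutside_toCNF]

theorem mem_Th_toCNF {r : RawCNF} {ψ : CNF Var} :
    ψ ∈ Th {r.toCNF} ↔ ∀ w, r.eval w = true → CNF.Sat w ψ := by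
  simp only [mem_Th_singleton, sat_toCNF]

variable {I : RawInstance} {B : List Var} {L A : List (List Var)} {l l' : List RawDefault}

theorem conclusions_isPositiveUnitOutside (hI : I.Forall (·.IsPositiveUnitOutside B))
    (hl : l ⊆ I.rules) : (I.conclusions l).IsPositiveUnitOutside B := by
  intro C hC
  rcases List.mem_append.1 hC with hC | hC
  · obtain ⟨r, hr, hC⟩ := List.mem_flatten.1 hC
    exact hI.1 r hr C hC
  · obtain ⟨d, hd, hC⟩ := List.mem_flatMap.1 hC
    exact (hI.2 d (hl hd)).2.2 C hC

theorem eval_conclusions (w : Var → Bool) (l : List RawDefault) :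
    (I.conclusions l).eval w = true ↔
      (∀ r ∈ I.kb, r.eval w = true) ∧ ∀ d ∈ l, d.2.2.eval w = true := by
  simp only [eval, conclusions, List.all_append, List.all_flatten, List.all_flatMap,
    Bool.and_eq_true, List.all_eq_true (l := I.kb), List.all_eq_true (l := l)]

theorem eval_conclusions_mono (h : l ⊆ l') {w : Var → Bool}
    (hw : (I.conclusions l').eval w = true) : (I.conclusions l).eval w = true := by
  rw [eval_conclusions] at hw ⊢
  exact ⟨hw.1, fun d hd => hw.2 d (h hd)⟩

theorem mem_applyRules (hL : Covers B L) (hI : I.Forall (·.IsPositiveUnitOutside B))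
    (hl : l ⊆ I.rules) {d : RawDefault} :
    d ∈ I.applyRules B L A l ↔ d ∈ I.rules ∧
      (∀ w, (I.conclusions l).eval w = true → d.1.eval w = true) ∧
      ∃ v ∈ A, d.2.1.eval (greatest B v) = true := by
  rw [applyRules, List.mem_filter, applicable, Bool.and_eq_true, List.any_eq_true]
  exact and_congr_right fun hd => and_congr_left fun _ =>
    entails_iff hL (conclusions_isPositiveUnitOutside hI hl) (hI.2 d hd).1

theorem applyRules_sublist (l : List RawDefault) :
    (I.applyRules B L A l).Sublist I.rules := List.filter_sublist

theorem applyRules_mono (hL : Covers B L) (hI : I.Forall (·.IsPositiveUnitOutside B))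
    (hl' : l' ⊆ I.rules) (h : l ⊆ l') :
    (I.applyRules B L A l).Sublist (I.applyRules B L A l') := by
  have heq : I.applyRules B L A l =
      (I.applyRules B L A l').filter (applicable B L A (I.conclusions l)) := by
    rw [applyRules, applyRules, List.filter_filter]
    refine List.filter_congr fun d hd => ?_
    rw [Bool.eq_iff_iff, Bool.and_eq_true, iff_self_and]
    intro happ
    have hmem : d ∈ I.applyRules B L A l := List.mem_filter.2 ⟨hd, happ⟩
    obtain ⟨-, hpre, hjust⟩ := (mem_applyRules hL hI (List.Subset.trans h hl')).1 hmem
    exact (List.mem_filter.1 ((mem_applyRules hL hI hl').2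
      ⟨hd, fun w hw => hpre w (eval_conclusions_mono h hw), hjust⟩)).2
  rw [heq]
  exact List.filter_sublist

theorem appliedRules_eq_iterate :
    I.appliedRules B L A = (I.applyRules B L A)^[I.rules.length] [] :=
  List.foldl_const _ _ _

theorem iterate_applyRules_subset : ∀ n, (I.applyRules B L A)^[n] [] ⊆ I.rules
  | 0 => List.nil_subset _
  | n + 1 => by rw [Function.iterate_succ_apply']; exact (applyRules_sublist _).subset

theorem appliedRules_subset : I.appliedRules B L A ⊆ I.rules := by
  rw [appliedRules_eq_iterate]; exact iterate_applyRules_subset _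

theorem applyRules_appliedRules (hL : Covers B L) (hI : I.Forall (·.IsPositiveUnitOutside B)) :
    I.applyRules B L A (I.appliedRules B L A) = I.appliedRules B L A := by
  rw [appliedRules_eq_iterate]
  exact iterate_eq_of_sublist _ _ applyRules_sublist fun l l' hl' hll' =>
    applyRules_mono hL hI hl'.subset hll'.subset

theorem closure_isPositiveUnitOutside (hI : I.Forall (·.IsPositiveUnitOutside B)) :
    (I.closure B L A).IsPositiveUnitOutside B :=
  conclusions_isPositiveUnitOutside hI appliedRules_subset

theorem gammaClosed_Th_closure (hL : Covers B L) (hI : I.Forall (·.IsPositiveUnitOutside B))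
    {E : Set (CNF Var)} (hA : I.DecidesJustifications B A E) :
    I.theory.GammaClosed E (Th {(I.closure B L A).toCNF}) := by
  refine ⟨fun φ hφ => ?_, (Th_Th _).symm, fun δ hδ hp hj => ?_⟩
  · obtain ⟨r, hr, rfl⟩ := mem_theory_W.1 hφ
    exact mem_Th_toCNF.2 fun w hw => (sat_toCNF w r).2 (((eval_conclusions w _).1 hw).1 r hr)
  · obtain ⟨d, hd, rfl⟩ := mem_theory_D.1 hδ
    simp only [mem_Th_toCNF, sat_toCNF] at hp ⊢
    have hmem : d ∈ I.appliedRules B L A := by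
      rw [← applyRules_appliedRules hL hI, mem_applyRules hL hI appliedRules_subset]
      exact ⟨hd, hp, not_not.1 (mt (hA d hd).2 hj)⟩
    exact fun w hw => ((eval_conclusions w _).1 hw).2 d hmem

theorem closure_mem_of_gammaClosed (hL : Covers B L) (hI : I.Forall (·.IsPositiveUnitOutside B))
    {E S : Set (CNF Var)} (hA : I.DecidesJustifications B A E) (hS : I.theory.GammaClosed E S) :
    (I.closure B L A).toCNF ∈ S := by
  suffices h : ∀ n, ∀ w, (∀ φ ∈ S, CNF.Sat w φ) →
      (I.conclusions ((I.applyRules B L A)^[n] [])).eval w = true by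
    rw [hS.closed, closure, appliedRules_eq_iterate]
    exact fun w hw => (sat_toCNF w _).2 (h _ w hw)
  have hkb : ∀ w, (∀ φ ∈ S, CNF.Sat w φ) → ∀ r ∈ I.kb, r.eval w = true := fun w hw r hr =>
    (sat_toCNF w r).1 (hw _ (hS.base _ (mem_theory_W.2 ⟨r, hr, rfl⟩)))
  intro n
  induction n with
  | zero => exact fun w hw => (eval_conclusions w []).2 ⟨hkb w hw, by simp⟩
  | succ n ih =>
    refine fun w hw => (eval_conclusions w _).2 ⟨hkb w hw, fun d hd => ?_⟩
    rw [Function.iterate_succ_apply', mem_applyRules hL hI (iterate_applyRules_subset n)] at hd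
    obtain ⟨hd, hpre, hjust⟩ := hd
    have hpreS : d.1.toCNF ∈ S := by
      rw [hS.closed]
      exact fun w' hw' => (sat_toCNF w' d.1).2 (hpre w' (ih w' hw'))
    rw [← sat_toCNF]
    exact hw _ (hS.rules _ (mem_theory_D.2 ⟨d, hd, rfl⟩) hpreS fun h => (hA d hd).1 h hjust)

theorem gamma_eq (hL : Covers B L) (hI : I.Forall (·.IsPositiveUnitOutside B))
    {E : Set (CNF Var)} (hA : I.DecidesJustifications B A E) :
    I.theory.Gamma E = Th {(I.closure B L A).toCNF} := by
  have hleast := I.theory.gamma_isLeast E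
  refine Set.Subset.antisymm (hleast.2 (gammaClosed_Th_closure hL hI hA)) ?_
  refine (Th_mono ?_).trans hleast.1.closed.ge
  exact Set.singleton_subset_iff.2 (closure_mem_of_gammaClosed hL hI hA hleast.1)

theorem decidesJustifications_Th (hL : Covers B L) (hI : I.Forall (·.IsPositiveUnitOutside B))
    {S : Set (CNF Var)} (hS : ∀ φ ∈ S, φ.IsPositiveUnitOutside B.toFinset)
    (hA : ∀ v, v ∈ A ↔ v ∈ L ∧ ∀ φ ∈ S, CNF.Sat (greatest B v) φ) :
    I.DecidesJustifications B A (Th S) := by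
  intro d hd
  simp only [negMem_Th_iff, sat_toCNF, not_exists, not_and]
  constructor
  · exact fun h v hv => h _ ((hA v).1 hv).2
  · intro h w hw hβw
    obtain ⟨v, hv, hvw⟩ := hL.exists_agrees w
    exact h v ((hA v).2 ⟨hv, fun φ hφ => (hS φ hφ).sat_greatest hvw (hw φ hφ)⟩)
      (eval_greatest (hI.2 d hd).2.1 hvw hβw)

theorem accepts_iff : I.accepts B L A = true ↔ A = consistentPart B L (I.closure B L A) :=
  decide_eq_true_iff

theorem isStableExtension_of_accepts (hL : Covers B L)
    (hI : I.Forall (·.IsPositiveUnitOutside B)) (h : I.accepts B L A = true) :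
    I.theory.IsStableExtension (Th {(I.closure B L A).toCNF}) := by
  refine (gamma_eq hL hI (decidesJustifications_Th hL hI ?_ fun v => ?_)).symm
  · rintro φ rfl
    exact (isPositiveUnitOutside_toCNF B _).2 (closure_isPositiveUnitOutside hI)
  · conv_lhs => rw [accepts_iff.1 h]
    simp only [consistentPart, List.mem_filter, Set.mem_singleton_iff, forall_eq, sat_toCNF]

theorem exists_accepts_of_isStableExtension (hL : Covers B L)
    (hI : I.Forall (·.IsPositiveUnitOutside B)) {E : Set (CNF Var)}
    (hE : I.theory.IsStableExtension E) :
    ∃ A, A.Sublist L ∧ I.accepts B L A = true ∧ E = Th {(I.closure B L A).toCNF} := by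
  classical
  set G := I.theory.generators E
  have hEG : E = Th G := hE.eq_Th_generators
  have hG : ∀ φ ∈ G, φ.IsPositiveUnitOutside B.toFinset := fun φ hφ =>
    ((theory_forall_isPositiveUnitOutside I B).2 hI).of_mem_generators hφ
  set A := L.filter fun v => decide (∀ φ ∈ G, CNF.Sat (greatest B v) φ) with hA
  have hAE : I.DecidesJustifications B A E := by
    rw [hEG]
    exact decidesJustifications_Th hL hI hG fun v => by simp [hA]
  have hclosure : E = Th {(I.closure B L A).toCNF} := hE.trans (gamma_eq hL hI hAE)
  refine ⟨A, List.filter_sublist, accepts_iff.2 (List.filter_congr fun v _ => ?_), hclosure⟩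
  rw [Bool.eq_iff_iff, decide_eq_true_iff, forall_sat_iff_of_Th_eq (hEG.symm.trans hclosure)]
  simp only [Set.mem_singleton_iff, forall_eq, sat_toCNF]

theorem bot_notMem_Th_closure_iff (hL : Covers B L) (hI : I.Forall (·.IsPositiveUnitOutside B))
    (h : I.accepts B L A = true) :
    CNF.bot ∉ Th {(I.closure B L A).toCNF} ↔ A.isEmpty = false := by
  have hbot : ∀ w : Var → Bool, ¬ CNF.Sat w CNF.bot := fun w => by simp [CNF.Sat, CNF.bot]
  have hmodel : (∃ w, (I.closure B L A).eval w = true) ↔ ∃ v, v ∈ A := by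
    conv_rhs => rw [accepts_iff.1 h]
    simp only [consistentPart, List.mem_filter]
    constructor
    · rintro ⟨w, hw⟩
      obtain ⟨v, hv, hvw⟩ := hL.exists_agrees w
      exact ⟨v, hv, eval_greatest (closure_isPositiveUnitOutside hI) hvw hw⟩
    · rintro ⟨v, -, hv⟩
      exact ⟨_, hv⟩
  simp only [mem_Th_toCNF, hbot, imp_false, not_forall, not_not, hmodel,
    List.isEmpty_eq_false_iff_exists_mem]

theorem hasStableExtension_iff (hL : Covers B L) (hI : I.Forall (·.IsPositiveUnitOutside B)) :
    I.theory.HasStableExtension ↔ ∃ A, A.Sublist L ∧ I.accepts B L A = true := by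
  constructor
  · rintro ⟨E, hE⟩
    obtain ⟨A, hA, h, -⟩ := exists_accepts_of_isStableExtension hL hI hE
    exact ⟨A, hA, h⟩
  · rintro ⟨A, -, h⟩
    exact ⟨_, isStableExtension_of_accepts hL hI h⟩

theorem hasConsistentStableExtension_iff (hL : Covers B L)
    (hI : I.Forall (·.IsPositiveUnitOutside B)) :
    I.theory.HasConsistentStableExtension ↔
      ∃ A, A.Sublist L ∧ I.accepts B L A = true ∧ A.isEmpty = false := by
  constructor
  · rintro ⟨E, hE, hbot⟩
    obtain ⟨A, hA, h, rfl⟩ := exists_accepts_of_isStableExtension hL hI hE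
    exact ⟨A, hA, h, (bot_notMem_Th_closure_iff hL hI h).1 hbot⟩
  · rintro ⟨A, -, h, hne⟩
    exact ⟨_, isStableExtension_of_accepts hL hI h, (bot_notMem_Th_closure_iff hL hI h).2 hne⟩

end RawInstance

end DefaultLogic

/-! ### Reading instances -/

namespace DefaultLogic

/-- The sign of a literal: true for a positive literal. -/
def Literal.isPos {V : Type} : Literal V → Bool
  | pos _ => true
  | neg _ => false

/-- The literal with a given sign and variable. -/
def Literal.mk {V : Type} (s : Bool) (x : V) : Literal V := bif s then pos x else neg x

/-- The state of the parser: the bits of the current variable, the sign of the current literal,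
the current clause, formula, and part of the input, and the previous parts, all of them
in reversed order. -/
abbrev ParseState :=
  Var × Bool × List (Literal Var) × RawCNF × List RawCNF × List (List RawCNF × List (Literal Var))

/-- The transition of the parser on a symbol. A backdoor variable is read as a positive literal of
the clause that is current at the end of its part of the input. -/
def parseStep : ParseState → Symb → ParseState
  | (v, s, c, f, p, q), .bit b => (b :: v, s, c, f, p, q)
  | (v, _, c, f, p, q), .pos => (v, true, c, f, p, q)
  | (v, _, c, f, p, q), .neg => (v, false, c, f, p, q)
  | (v, s, c, f, p, q), .endVar => ([], true, Literal.mk s v.reverse :: c, f, p, q)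
  | (v, s, c, f, p, q), .endClause => (v, s, [], c.reverse :: f, p, q)
  | (v, s, c, f, p, q), .endFormula => (v, s, c, [], f.reverse :: p, q)
  | (v, s, c, f, p, q), .endPart => (v, s, [], f, [], (p.reverse, c.reverse) :: q)

/-- The parts of the input, in reversed order: each consists of a list of formulas and of the
literals that are left over. -/
def parseParts (x : List Symb) : List (List RawCNF × List (Literal Var)) :=
  (x.foldl parseStep ([], true, [], [], [], [])).2.2.2.2.2

/-- One step of `triples`: the state consists of the incomplete triple, in reversed order, and of
the previous triples. -/
def tripleStep {α : Type} (s : List α × List (α × α × α)) (a : α) : List α × List (α × α × α) :=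
  if s.1.tail.isEmpty = true then (a :: s.1, s.2)
  else ([], (s.1.tail.headD a, s.1.headD a, a) :: s.2)

/-- The list split into consecutive triples, as it is needed to recover the rules from the list of
their formulas. -/
def triples {α : Type} (l : List α) : List (α × α × α) := (l.foldl tripleStep ([], [])).2.reverse

/-- The instance that is encoded by a word, with junk values if there is none. -/
def parse (x : List Symb) : RawInstance where
  kb := ((parseParts x).tail.tail.headD ([], [])).1
  rules := triples ((parseParts x).tail.headD ([], [])).1
  backdoor := ((parseParts x).headD ([], [])).2.map Literal.var

theorem foldl_flatMap_eq {α β σ : Type} {step : σ → β → σ} {c : α → List β} {st : List α → σ}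
    (h : ∀ a acc, (c a).foldl step (st acc) = st (a :: acc)) (l : List α) (acc : List α) :
    (l.flatMap c).foldl step (st acc) = st (l.reverse ++ acc) := by
  induction l generalizing acc with
  | nil => rfl
  | cons a l ih =>
    rw [List.flatMap_cons, List.foldl_append, h, ih, List.reverse_cons, List.append_assoc,
      List.singleton_append]

theorem foldl_encodeListWith {α σ : Type} {step : σ → Symb → σ} {e : Symb} {c : α → List Symb}
    {st : List α → σ} (h : ∀ a acc, (c a).foldl step (st acc) = st (a :: acc)) (l : List α) :
    (encodeListWith e c l).foldl step (st []) = step (st l.reverse) e := by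
  rw [encodeListWith, List.foldl_append, foldl_flatMap_eq h, List.append_nil, List.foldl_cons,
    List.foldl_nil]

theorem triples_flatMap {α : Type} (l : List (α × α × α)) :
    triples (l.flatMap fun d => [d.1, d.2.1, d.2.2]) = l := by
  have hstep : ∀ (d : α × α × α) acc,
      [d.1, d.2.1, d.2.2].foldl tripleStep ([], acc) = ([], d :: acc) := fun d acc => by
    simp [tripleStep]
  rw [triples, foldl_flatMap_eq (st := fun acc => ([], acc)) hstep, List.append_nil,
    List.reverse_reverse]

section

variable (c : List (Literal Var)) (f : RawCNF) (p : List RawCNF)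
  (q : List (List RawCNF × List (Literal Var)))

theorem foldl_encodeVar (x : Var) (s : Bool) :
    (encodeVar x).foldl parseStep ([], s, c, f, p, q) =
      ([], true, Literal.mk s x :: c, f, p, q) := by
  refine (foldl_encodeListWith (st := fun v => (v, s, c, f, p, q)) (fun _ _ => rfl) x).trans ?_
  rw [parseStep, List.reverse_reverse]

theorem foldl_encodeLiteral (l : Literal Var) :
    (encodeLiteral l).foldl parseStep ([], true, c, f, p, q) = ([], true, l :: c, f, p, q) := by
  cases l with
  | pos x => exact foldl_encodeVar c f p q x true
  | neg x => exact foldl_encodeVar c f p q x false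

theorem foldl_encodeClause (C : List (Literal Var)) :
    (encodeListWith .endClause encodeLiteral C).foldl parseStep ([], true, [], f, p, q) =
      ([], true, [], C :: f, p, q) := by
  refine (foldl_encodeListWith (st := fun c => ([], true, c, f, p, q))
    (fun l c => foldl_encodeLiteral c f p q l) C).trans ?_
  rw [parseStep, List.reverse_reverse]

theorem foldl_encodeCNF (r : RawCNF) :
    (encodeCNF r).foldl parseStep ([], true, [], [], p, q) = ([], true, [], [], r :: p, q) := by
  refine (foldl_encodeListWith (st := fun f => ([], true, [], f, p, q))
    (fun C f => foldl_encodeClause f p q C) r).trans ?_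
  rw [parseStep, List.reverse_reverse]

theorem foldl_encode_kb (kb : List RawCNF) :
    (encodeListWith .endPart encodeCNF kb).foldl parseStep ([], true, [], [], [], q) =
      ([], true, [], [], [], (kb, []) :: q) := by
  refine (foldl_encodeListWith (st := fun p => ([], true, [], [], p, q))
    (fun r p => foldl_encodeCNF p q r) kb).trans ?_
  rw [parseStep, List.reverse_reverse, List.reverse_nil]

theorem encode_rules (rules : List RawDefault) :
    encodeListWith .endPart encodeDefault rules =
      encodeListWith .endPart encodeCNF (rules.flatMap fun d => [d.1, d.2.1, d.2.2]) := by
  have henc : encodeDefault = fun d => [d.1, d.2.1, d.2.2].flatMap encodeCNF := by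
    funext d
    simp only [encodeDefault, List.flatMap_cons, List.flatMap_nil, List.append_nil,
      List.append_assoc]
  rw [encodeListWith, encodeListWith, List.flatMap_assoc, henc]

theorem foldl_encode_backdoor (B : List Var) :
    (encodeListWith .endPart encodeVar B).foldl parseStep ([], true, [], [], [], q) =
      ([], true, [], [], [], ([], B.map .pos) :: q) := by
  refine (foldl_encodeListWith (st := fun l => ([], true, l.map .pos, [], [], q))
    (fun x l => foldl_encodeVar _ _ _ _ x true) B).trans ?_
  rw [parseStep, List.map_reverse, List.reverse_reverse, List.reverse_nil]

end

theorem parseParts_encode (I : RawInstance) : parseParts I.encode =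
    [([], I.backdoor.map .pos), (I.rules.flatMap fun d => [d.1, d.2.1, d.2.2], []),
      (I.kb, [])] := by
  rw [parseParts, RawInstance.encode, encode_rules, List.foldl_append, List.foldl_append,
    foldl_encode_kb, foldl_encode_kb, foldl_encode_backdoor]

theorem parse_encode (I : RawInstance) : parse I.encode = I := by
  simp [parse, parseParts_encode, triples_flatMap, Literal.var, Function.comp_def]

end DefaultLogic

/-! ### Deciding the problem -/

namespace DefaultLogic

section

variable {α ν : Type} {n : List ν} {l : List α}

/-- The list of all sublists of `l`, cut off at as many sublists as `n` has entries. The cut-off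
makes the function computable in polynomial time. -/
def sublistsUpTo (n : List ν) (l : List α) : List (List α) :=
  l.reverse.foldl (fun s a => (s ++ s.map (a :: ·)).take n.length) [[]]

theorem sublistsUpTo_cons (n : List ν) (a : α) (l : List α) : sublistsUpTo n (a :: l) =
    (sublistsUpTo n l ++ (sublistsUpTo n l).map (a :: ·)).take n.length := by
  simp only [sublistsUpTo, List.foldl_reverse, List.foldr_cons]

theorem sublistsUpTo_eq (h : 2 ^ l.length ≤ n.length) : sublistsUpTo n l = l.sublists' := by
  induction l with
  | nil => rfl
  | cons a l ih =>
    rw [List.length_cons, pow_succ] at h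
    rw [sublistsUpTo_cons, ih (by lia), List.sublists'_cons, List.take_of_length_le]
    rw [List.length_append, List.length_map, List.length_sublists']
    lia

theorem length_sublistsUpTo_le (n : List ν) (l : List α) :
    (sublistsUpTo n l).length ≤ n.length + 1 := by
  cases l with
  | nil => exact Nat.le_add_left _ _
  | cons a l =>
    rw [sublistsUpTo_cons]
    exact (List.length_take_le _ _).trans (Nat.le_succ _)

theorem sublist_of_mem_sublistsUpTo {m : List α} (h : m ∈ sublistsUpTo n l) : m.Sublist l := by
  induction l generalizing m with
  | nil => exact List.mem_singleton.1 h ▸ List.Sublist.refl _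
  | cons a l ih =>
    rw [sublistsUpTo_cons] at h
    rcases List.mem_append.1 (List.mem_of_mem_take h) with h | h
    · exact (ih h).cons a
    · obtain ⟨m', hm', rfl⟩ := List.mem_map.1 h
      exact (ih hm').cons_cons a

end

/-- A test for two lists to have the same length. -/
def sameLength {α β : Type} (l : List α) (m : List β) : Bool :=
  decide ((l.map fun _ => ()) = m.map fun _ => ())

theorem sameLength_eq_true {α β : Type} {l : List α} {m : List β} :
    sameLength l m = true ↔ l.length = m.length := by
  simp [sameLength, List.map_const', List.replicate_inj]

theorem covers_sublists' (B : List Var) : Covers B B.sublists' where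
  subset _ hv := (List.mem_sublists'.1 hv).subset
  exists_agrees w := ⟨B.filter w, List.mem_sublists'.2 List.filter_sublist, fun x hx => by
    simp [assignment, hx]⟩

theorem DefaultTheory.mem_vars_iff {V : Type} [DecidableEq V] (T : DefaultTheory V) (x : V) :
    x ∈ T.vars ↔ ¬ T.Forall fun φ => x ∉ φ.vars := by
  simp only [DefaultTheory.vars, Default.vars, DefaultTheory.Forall, Finset.mem_union,
    Finset.mem_biUnion]
  grind

namespace RawInstance

open RawCNF

/-- The formulas of the instance. -/
def formulas (I : RawInstance) : List RawCNF :=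
  I.kb ++ I.rules.flatMap fun d => [d.1, d.2.1, d.2.2]

/-- The clauses of the formulas of the instance. -/
def clauses (I : RawInstance) : List (List (Literal Var)) := I.formulas.flatten

/-- A test for the variables in `B` to occur in the instance. -/
def containsVars (I : RawInstance) (B : List Var) : Bool :=
  B.all fun x => I.clauses.any fun C => C.any fun l => decide (l.var = x)

/-- A test for the instance to satisfy `RawCNF.IsPositiveUnitOutside`. -/
def isPositiveUnitOutside (I : RawInstance) (B : List Var) : Bool :=
  I.clauses.all fun C => C.all fun l => decide (l.var ∈ B) ||
    (l.isPos && C.all fun l' => decide (l'.var ∈ B) || decide (l' = l))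

theorem forall_iff_formulas (I : RawInstance) (p : RawCNF → Prop) :
    I.Forall p ↔ ∀ r ∈ I.formulas, p r := by
  simp only [Forall, formulas, List.forall_mem_append, List.forall_mem_flatMap,
    List.forall_mem_cons, List.not_mem_nil, false_implies, implies_true, and_true]

theorem forall_iff_clauses (I : RawInstance) (p : List (Literal Var) → Prop) :
    (I.Forall fun r => ∀ C ∈ r, p C) ↔ ∀ C ∈ I.clauses, p C := by
  rw [forall_iff_formulas, clauses, List.forall_mem_flatten]

theorem isPositiveUnitOutside_iff (I : RawInstance) (B : List Var) :
    I.isPositiveUnitOutside B = true ↔ I.Forall (·.IsPositiveUnitOutside B) := by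
  have hpos : ∀ l : Literal Var, l.isPos = true ↔ ∃ x, l = .pos x := fun l => by
    cases l <;> simp [Literal.isPos]
  simp only [IsPositiveUnitOutside, forall_iff_clauses, isPositiveUnitOutside, List.all_eq_true,
    Bool.or_eq_true, decide_eq_true_eq, Bool.and_eq_true, hpos, or_iff_not_imp_left]

theorem containsVars_iff (I : RawInstance) (B : List Var) :
    I.containsVars B = true ↔ B.toFinset ⊆ I.theory.vars := by
  have hvars : ∀ x, x ∈ I.theory.vars ↔ ∃ C ∈ I.clauses, ∃ l ∈ C, l.var = x := fun x => by
    have hnotMem : ∀ r : RawCNF, x ∉ r.toCNF.vars ↔ ∀ C ∈ r, ¬ ∃ l ∈ C, l.var = x := fun r => by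
      simp [CNF.vars, toCNF]
    simp only [DefaultTheory.mem_vars_iff, theory_forall, hnotMem, forall_iff_clauses, not_forall,
      not_not, exists_prop]
  simp only [containsVars, List.all_eq_true, List.any_eq_true, decide_eq_true_eq,
    Finset.subset_iff, List.mem_toFinset, hvars]

/-- A search for a list of assignments of the variables in `B` that is accepted and satisfies
`test`. The length of `n` bounds the number of candidates. -/
def search {ν : Type} (test : List (List Var) → Bool) (n : List ν) (I : RawInstance)
    (B : List Var) : Bool :=
  (sublistsUpTo n (sublistsUpTo n B)).any fun A =>
    I.accepts B (sublistsUpTo n B) A && test A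

theorem search_eq_true {ν : Type} {test : List (List Var) → Bool} {n : List ν}
    (I : RawInstance) {B : List Var} (h : 2 ^ 2 ^ B.length ≤ n.length) : I.search test n B = true ↔
      ∃ A, A.Sublist B.sublists' ∧ I.accepts B B.sublists' A = true ∧ test A = true := by
  have hassignments : sublistsUpTo n B = B.sublists' :=
    sublistsUpTo_eq (Nat.lt_two_pow_self.le.trans h)
  have hguesses : sublistsUpTo n B.sublists' = B.sublists'.sublists' :=
    sublistsUpTo_eq (by rwa [List.length_sublists'])
  simp only [search, hassignments, hguesses, List.any_eq_true, List.mem_sublists',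
    Bool.and_eq_true]

/-- A test for a yes-instance with the backdoor `B`. The number of entries `0` of `y` has to be
the parameter, and the length of `y` bounds the search. -/
def isYesInstance (test : List (List Var) → Bool) (y : List (Fin 2)) (I : RawInstance)
    (B : List Var) : Bool :=
  I.containsVars B && (I.isPositiveUnitOutside B &&
    (sameLength B (y.filter fun i => decide (i = 0)) && I.search test y B))

theorem isStrongBackdoor_classID_iff (I : RawInstance) :
    I.theory.IsStrongBackdoor classID I.backdoorSet ↔
      I.containsVars I.backdoor.dedup = true ∧
        I.isPositiveUnitOutside I.backdoor.dedup = true := by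
  have hset : I.backdoorSet = I.backdoor.dedup.toFinset := by
    ext x
    simp only [backdoorSet, List.mem_toFinset, List.mem_dedup]
  rw [DefaultLogic.isStrongBackdoor_classID_iff, hset, containsVars_iff,
    isPositiveUnitOutside_iff, theory_forall_isPositiveUnitOutside]

end RawInstance

/-- The decision procedure for a property of default theories. A theory has the property iff it has
a stable extension for which the guess `A` of `RawInstance.accepts` satisfies `test`. -/
def decision (test : List (List Var) → Bool) (x : List Symb) (y : List (Fin 2)) : Bool :=
  decide ((parse x).encode = x) && (parse x).isYesInstance test y (parse x).backdoor.dedup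

/-- The second component of the instances for the parameter `k`, which contains the entries `1`
as the time that is needed for the `2 ^ 2 ^ k` guesses. -/
def paddedParameter (k : ℕ) : List (Fin 2) :=
  List.replicate k 0 ++ List.replicate (2 ^ 2 ^ k) 1

/-- The property `Q` of a theory is witnessed by the accepted guesses that satisfy `test`. -/
def IsWitnessedBy (Q : DefaultTheory Var → Prop) (test : List (List Var) → Bool) : Prop :=
  ∀ (I : RawInstance) (B : List Var) (L : List (List Var)), Covers B L →
    I.Forall (·.IsPositiveUnitOutside B) →
      (Q I.theory ↔ ∃ A, A.Sublist L ∧ I.accepts B L A = true ∧ test A = true)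

theorem isWitnessedBy_hasStableExtension :
    IsWitnessedBy DefaultTheory.HasStableExtension fun _ => true := fun _ _ _ hL hI => by
  simpa only [and_true] using RawInstance.hasStableExtension_iff hL hI

theorem isWitnessedBy_hasConsistentStableExtension :
    IsWitnessedBy DefaultTheory.HasConsistentStableExtension fun A => !A.isEmpty :=
  fun _ _ _ hL hI => by
    simpa only [Bool.not_eq_true'] using RawInstance.hasConsistentStableExtension_iff hL hI

section

variable {Q : DefaultTheory Var → Prop} {test : List (List Var) → Bool}

theorem IsWitnessedBy.isYesInstance_iff (h : IsWitnessedBy Q test) (I : RawInstance) (k : ℕ) :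
    I.isYesInstance test (paddedParameter k) I.backdoor.dedup = true ↔
      I.theory.IsStrongBackdoor classID I.backdoorSet ∧ I.backdoorSet.card = k ∧ Q I.theory := by
  have hfilter : ((paddedParameter k).filter fun i => decide (i = 0)).length = k := by
    simp [paddedParameter]
  have hcard : I.backdoorSet.card = I.backdoor.dedup.length := List.card_toFinset _
  simp only [RawInstance.isYesInstance, Bool.and_eq_true, sameLength_eq_true, hfilter,
    RawInstance.isStrongBackdoor_classID_iff, hcard, and_assoc]
  refine and_congr_right fun _ => and_congr_right fun hI => and_congr_right fun hk => ?_
  rw [RawInstance.search_eq_true I (by simp [paddedParameter, hk])]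
  exact (h I _ _ (covers_sublists' _) ((I.isPositiveUnitOutside_iff _).1 hI)).symm

theorem IsWitnessedBy.mem_backdoorEvaluation_iff (h : IsWitnessedBy Q test) (x : List Symb)
    (k : ℕ) : (x, k) ∈ backdoorEvaluation Q classCNF classID ↔
      decision test x (paddedParameter k) = true := by
  have hclass : ∀ T : DefaultTheory Var, T.InClass classCNF := fun T => by
    simp [DefaultTheory.InClass, classCNF]
  rw [decision, Bool.and_eq_true, decide_eq_true_eq, h.isYesInstance_iff]
  constructor
  · rintro ⟨I, rfl, -, hI⟩
    rw [parse_encode]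
    exact ⟨rfl, hI⟩
  · exact fun ⟨hx, hI⟩ => ⟨parse x, hx, hclass _, hI⟩

end

end DefaultLogic

/-! ### Polynomial time of the decision procedure -/

namespace StackProgram

open Polynomial Coded

section FiniteTypes

variable {α : Type} [Fintype α]

/-- A code for the elements of a finite type: `n` times `true` for the element with index `n` in an
enumeration of the type. -/
noncomputable def unaryCode (a : α) : List Bool := List.replicate (Fintype.equivFin α a) true

theorem unaryCode_injective : Function.Injective (unaryCode (α := α)) :=
  fun _ _ h => (Fintype.equivFin α).injective (Fin.ext (List.replicate_inj.1 h).1)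

/-- The elements of the finite type `α` are represented as trees by their codes `unaryCode`. -/
class IsUnaryCoded (α : Type) [Fintype α] [Coded α] : Prop where
  toData_eq : ∀ a : α, toData a = toData (unaryCode a)

end FiniteTypes

section Size

variable {α : Type} [Coded α] {l m : List α}

theorem size_le_of_sublist (h : l.Sublist m) : size l ≤ size m := by
  induction h with
  | slnil => exact le_rfl
  | cons a _ ih => rw [size_cons]; omega
  | cons_cons a _ ih => rw [size_cons, size_cons]; omega

theorem size_reverse (l : List α) : size l.reverse = size l := by
  induction l with
  | nil => rfl
  | cons a l ih =>
    have happend := size_append l.reverse [a]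
    rw [size_cons, size_nil] at happend
    rw [List.reverse_cons, size_cons]
    omega

theorem size_le_of_forall {K : ℕ} (h : ∀ a ∈ l, size a ≤ K) :
    size l ≤ l.length * (K + 1) + 1 := by
  induction l with
  | nil => exact Nat.le_add_left _ _
  | cons a l ih =>
    have hhead := h a List.mem_cons_self
    have htail := ih fun b hb => h b (List.mem_cons_of_mem _ hb)
    rw [size_cons, List.length_cons, Nat.succ_mul]
    omega

end Size

namespace PolyTime

variable {A : Type} {α β γ ν : Type} [Coded α] [Coded β] [Coded γ] [Coded ν]

theorem comp_fst {f : γ → β} (hf : PolyTime A f) : PolyTime A fun x : γ × α => f x.1 :=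
  hf.comp id.fst

theorem comp_fst₂ {f : γ → ν → β} (hf : PolyTime A fun x : γ × ν => f x.1 x.2) :
    PolyTime A fun x : (γ × α) × ν => f x.1.1 x.2 :=
  hf.comp (id.fst.fst.pair id.snd)

theorem unit_eq : PolyTime A fun x : Unit × Unit => decide (x.1 = x.2) := const true

theorem fintype_eq [Fintype α] [IsUnaryCoded α] [DecidableEq α] {f g : γ → α}
    (hf : PolyTime A f) (hg : PolyTime A g) : PolyTime A fun c => decide (f c = g c) := by
  have hcode : PolyTime A (unaryCode (α := α)) :=
    of_toData fun a => (IsUnaryCoded.toData_eq a).symm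
  simpa only [unaryCode_injective.eq_iff] using
    list_eq (bool_eq id.fst id.snd) (hcode.comp hf) (hcode.comp hg)

theorem fintype_cases [Fintype α] [IsUnaryCoded α] [Nonempty α] {f : γ → α → β} {g : γ → α}
    (hg : PolyTime A g) (hf : ∀ a, PolyTime A fun c => f c a) : PolyTime A fun c => f c (g c) := by
  classical
  have hlist : ∀ l : List α, ∃ f' : γ → β, PolyTime A f' ∧ ∀ c, g c ∈ l → f' c = f c (g c) := by
    intro l
    induction l with
    | nil =>
      obtain ⟨a⟩ := ‹Nonempty α›
      exact ⟨_, hf a, fun _ h => absurd h List.not_mem_nil⟩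
    | cons a l ih =>
      obtain ⟨f', hf', hl⟩ := ih
      refine ⟨_, ite (fintype_eq hg (const a)) (hf a) hf', fun c hc => ?_⟩
      by_cases ha : g c = a
      · simp [ha]
      · simpa [ha] using hl c ((List.mem_cons.1 hc).resolve_left ha)
  obtain ⟨f', hf', huniv⟩ := hlist Finset.univ.toList
  rwa [show f' = fun c => f c (g c) from
    funext fun c => huniv c (Finset.mem_toList.2 (Finset.mem_univ _))] at hf'

end PolyTime

end StackProgram

namespace DefaultLogic

open StackProgram StackProgram.Coded

noncomputable instance : Coded Symb := ⟨fun a => toData (unaryCode a)⟩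
noncomputable instance : Coded (Fin 2) := ⟨fun a => toData (unaryCode a)⟩
noncomputable instance : Coded (Symb ⊕ Fin 2) := ⟨fun a => toData (unaryCode a)⟩
instance : IsUnaryCoded Symb := ⟨fun _ => rfl⟩
instance : IsUnaryCoded (Fin 2) := ⟨fun _ => rfl⟩
instance : IsUnaryCoded (Symb ⊕ Fin 2) := ⟨fun _ => rfl⟩
instance : Coded (Literal Var) := ⟨fun l => toData (l.isPos, l.var)⟩
instance : Coded RawInstance := ⟨fun I => toData (I.kb, I.rules, I.backdoor)⟩

end DefaultLogic

namespace StackProgram.PolyTime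

open Polynomial Coded DefaultLogic

variable {A γ : Type} [Coded γ]

section Literals

variable {f g : γ → Literal Var}

theorem var_eq {f g : γ → Var} (hf : PolyTime A f) (hg : PolyTime A g) :
    PolyTime A fun c => decide (f c = g c) := list_eq (bool_eq id.fst id.snd) hf hg

theorem var_mem {f : γ → Var} {g : γ → List Var} (hf : PolyTime A f) (hg : PolyTime A g) :
    PolyTime A fun c => decide (f c ∈ g c) := by
  convert mem (var_eq id.fst id.snd) hf hg

theorem literal_toProd (hf : PolyTime A f) : PolyTime A fun c => ((f c).isPos, (f c).var) :=
  (of_toData (f := fun l : Literal Var => (l.isPos, l.var)) fun _ => rfl).comp hf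

theorem isPos (hf : PolyTime A f) : PolyTime A fun c => (f c).isPos := hf.literal_toProd.fst

theorem var (hf : PolyTime A f) : PolyTime A fun c => (f c).var := hf.literal_toProd.snd

theorem literalMk {s : γ → Bool} {x : γ → Var} (hs : PolyTime A s) (hx : PolyTime A x) :
    PolyTime A fun c => Literal.mk (s c) (x c) :=
  (of_toData (f := fun p : Bool × Var => Literal.mk p.1 p.2) fun p => by
    obtain ⟨_ | _, x⟩ := p <;> rfl).comp (hs.pair hx)

theorem literal_eq (hf : PolyTime A f) (hg : PolyTime A g) :
    PolyTime A fun c => decide (f c = g c) := by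
  convert (bool_eq hf.isPos hg.isPos).and (var_eq hf.var hg.var) using 2 with c
  rw [Bool.eq_iff_iff, Bool.and_eq_true, decide_eq_true_iff, decide_eq_true_iff,
    decide_eq_true_iff]
  cases f c <;> cases g c <;> simp [Literal.isPos, Literal.var]

theorem literalEval {w : γ → Var → Bool} (hw : PolyTime A fun x : γ × Var => w x.1 x.2)
    (hf : PolyTime A f) : PolyTime A fun c => (f c).eval (w c) := by
  convert hf.isPos.ite (hw.comp₂ id hf.var) (hw.comp₂ id hf.var).not using 2 with c
  cases f c <;> simp [Literal.isPos, Literal.var, Literal.eval]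

end Literals

section Formulas

variable {w : γ → Var → Bool} {r α : γ → RawCNF} {B v : γ → List Var} {L : γ → List (List Var)}

theorem evalClause {f : γ → List (Literal Var)} (hw : PolyTime A fun x : γ × Var => w x.1 x.2)
    (hf : PolyTime A f) : PolyTime A fun c => RawCNF.evalClause (w c) (f c) :=
  any (p := fun c l => Literal.eval (w c) l) hf (literalEval hw.comp_fst₂ id.snd)

theorem evalCNF (hw : PolyTime A fun x : γ × Var => w x.1 x.2) (hr : PolyTime A r) :
    PolyTime A fun c => RawCNF.eval (w c) (r c) :=
  all (p := fun c C => RawCNF.evalClause (w c) C) hr (evalClause hw.comp_fst₂ id.snd)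

theorem assignment (hv : PolyTime A v) :
    PolyTime A fun x : γ × Var => DefaultLogic.assignment (v x.1) x.2 :=
  var_mem id.snd hv.comp_fst

theorem greatest (hB : PolyTime A B) (hv : PolyTime A v) :
    PolyTime A fun x : γ × Var => DefaultLogic.greatest (B x.1) (v x.1) x.2 :=
  hv.assignment.or (var_mem id.snd hB.comp_fst).not

theorem least (hB : PolyTime A B) (hv : PolyTime A v) (hr : PolyTime A r) :
    PolyTime A fun x : γ × Var => RawCNF.least (B x.1) (v x.1) (r x.1) x.2 :=
  hv.assignment.or <| (var_mem id.snd hB.comp_fst).not.and <|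
    any (p := fun (x : γ × Var) C =>
      !RawCNF.evalClause (DefaultLogic.assignment (v x.1)) C && decide (Literal.pos x.2 ∈ C))
      hr.comp_fst <| (evalClause hv.comp_fst.comp_fst.assignment id.snd).not.and <|
        mem (literal_eq id.fst id.snd) ((const true).literalMk id.fst.snd) id.snd

theorem entails (hB : PolyTime A B) (hL : PolyTime A L) (hr : PolyTime A r) (hα : PolyTime A α) :
    PolyTime A fun c => RawCNF.entails (B c) (L c) (r c) (α c) :=
  all (p := fun c v => !(r c).eval (DefaultLogic.greatest (B c) v) ||
    (α c).eval (RawCNF.least (B c) v (r c))) hL <|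
    (evalCNF (greatest hB.comp_fst id.snd) hr.comp_fst).not.or
      (evalCNF (least hB.comp_fst id.snd hr.comp_fst) hα.comp_fst)

theorem consistentPart (hB : PolyTime A B) (hL : PolyTime A L) (hr : PolyTime A r) :
    PolyTime A fun c => RawInstance.consistentPart (B c) (L c) (r c) :=
  filter (p := fun c v => (r c).eval (DefaultLogic.greatest (B c) v)) hL
    (evalCNF (greatest hB.comp_fst id.snd) hr.comp_fst)

end Formulas

section Extensions

variable {I : γ → RawInstance} {B : γ → List Var} {L M : γ → List (List Var)}

theorem instance_toProd (hI : PolyTime A I) :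
    PolyTime A fun c => ((I c).kb, (I c).rules, (I c).backdoor) :=
  (of_toData (f := fun J : RawInstance => (J.kb, J.rules, J.backdoor)) fun _ => rfl).comp hI

theorem kb (hI : PolyTime A I) : PolyTime A fun c => (I c).kb := hI.instance_toProd.fst

theorem rules (hI : PolyTime A I) : PolyTime A fun c => (I c).rules := hI.instance_toProd.snd.fst

theorem backdoor (hI : PolyTime A I) : PolyTime A fun c => (I c).backdoor :=
  hI.instance_toProd.snd.snd

theorem conclusions {l : γ → List RawDefault} (hI : PolyTime A I) (hl : PolyTime A l) :
    PolyTime A fun c => (I c).conclusions (l c) :=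
  hI.kb.flatten.append (flatMap (g := fun _ d => d.2.2) hl id.snd.snd.snd)

theorem applicable {r : γ → RawCNF} {d : γ → RawDefault} (hB : PolyTime A B) (hL : PolyTime A L)
    (hM : PolyTime A M) (hr : PolyTime A r) (hd : PolyTime A d) :
    PolyTime A fun c => RawInstance.applicable (B c) (L c) (M c) (r c) (d c) :=
  (entails hB hL hr hd.fst).and <|
    any (p := fun c v => (d c).2.1.eval (DefaultLogic.greatest (B c) v)) hM <|
      evalCNF (greatest hB.comp_fst id.snd) hd.comp_fst.snd.fst

theorem applyRules {l : γ → List RawDefault} (hI : PolyTime A I) (hB : PolyTime A B)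
    (hL : PolyTime A L) (hM : PolyTime A M) (hl : PolyTime A l) :
    PolyTime A fun c => (I c).applyRules (B c) (L c) (M c) (l c) :=
  filter (p := fun c d =>
    RawInstance.applicable (B c) (L c) (M c) ((I c).conclusions (l c)) d) hI.rules <|
    applicable hB.comp_fst hL.comp_fst hM.comp_fst (hI.conclusions hl).comp_fst id.snd

theorem appliedRules (hI : PolyTime A I) (hB : PolyTime A B) (hL : PolyTime A L)
    (hM : PolyTime A M) : PolyTime A fun c => (I c).appliedRules (B c) (L c) (M c) := by
  obtain ⟨P, hP⟩ := hI.rules.exists_size_le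
  have hstep : PolyTime A fun x : γ × List RawDefault × RawDefault =>
      (I x.1).applyRules (B x.1) (L x.1) (M x.1) x.2.1 :=
    applyRules hI.comp_fst hB.comp_fst hL.comp_fst hM.comp_fst id.snd.fst
  refine foldl (h := fun c l _ => (I c).applyRules (B c) (L c) (M c) l) (g := fun _ => [])
    hI.rules (const []) hstep P fun c l _ => le_trans (size_le_of_sublist ?_) (hP c)
  rcases List.eq_nil_or_concat l with rfl | ⟨l, d, rfl⟩
  · exact List.nil_sublist _
  · rw [List.concat_eq_append, List.foldl_append]
    exact List.filter_sublist

theorem closure (hI : PolyTime A I) (hB : PolyTime A B) (hL : PolyTime A L)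
    (hM : PolyTime A M) : PolyTime A fun c => (I c).closure (B c) (L c) (M c) :=
  hI.conclusions (hI.appliedRules hB hL hM)

theorem accepts (hI : PolyTime A I) (hB : PolyTime A B) (hL : PolyTime A L)
    (hM : PolyTime A M) : PolyTime A fun c => (I c).accepts (B c) (L c) (M c) :=
  list_eq (list_eq (var_eq id.fst id.snd) id.fst id.snd) hM
    (hB.consistentPart hL (hI.closure hB hL hM))

end Extensions

end StackProgram.PolyTime

namespace StackProgram.PolyTime

open Polynomial Coded DefaultLogic

variable {A γ : Type} [Coded γ]

section Parsing

theorem symb_eq : PolyTime A fun x : Symb × Symb => decide (x.1 = x.2) := fintype_eq id.fst id.snd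

theorem parseStep {s : γ → ParseState} {a : γ → Symb} (hs : PolyTime A s) (ha : PolyTime A a) :
    PolyTime A fun c => DefaultLogic.parseStep (s c) (a c) := by
  have : Nonempty Symb := ⟨.pos⟩
  refine fintype_cases (f := fun c a => DefaultLogic.parseStep (s c) a) ha fun a => ?_
  have hbits := hs.fst
  have hsign := hs.snd.fst
  have hclause := hs.snd.snd.fst
  have hformula := hs.snd.snd.snd.fst
  have hpart := hs.snd.snd.snd.snd.fst
  have hparts := hs.snd.snd.snd.snd.snd
  cases a with
  | bit b => exact ((const b).cons hbits).pair hs.snd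
  | pos => exact hbits.pair ((const true).pair hs.snd.snd)
  | neg => exact hbits.pair ((const false).pair hs.snd.snd)
  | endVar =>
    exact (const []).pair ((const true).pair
      (((hsign.literalMk hbits.reverse).cons hclause).pair hs.snd.snd.snd))
  | endClause =>
    exact hbits.pair (hsign.pair ((const []).pair
      ((hclause.reverse.cons hformula).pair hs.snd.snd.snd.snd)))
  | endFormula =>
    exact hbits.pair (hsign.pair (hclause.pair ((const []).pair
      ((hformula.reverse.cons hpart).pair hparts))))
  | endPart =>
    exact hbits.pair (hsign.pair ((const []).pair (hformula.pair ((const []).pair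
      ((hpart.reverse.pair hclause.reverse).cons hparts)))))

theorem size_literalMk (s : Bool) (x : Var) : size (Literal.mk s x) = size s + size x + 1 := by
  cases s <;> exact size_mk _ _

theorem size_parseStep_le (s : ParseState) (a : Symb) :
    size (DefaultLogic.parseStep s a) ≤ size s + 10 := by
  obtain ⟨v, l, c, f, p, q⟩ := s
  have hsign := size_bool_le l
  have htrue := size_bool_le true
  cases a with
  | bit b =>
    have hbit := size_bool_le b
    simp only [DefaultLogic.parseStep, size_mk, size_cons]
    omega
  | _ =>
    simp only [DefaultLogic.parseStep, size_mk, size_cons, size_nil, size_reverse, size_literalMk]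
    have hfalse := size_bool_le false
    omega

theorem parseParts {x : γ → List Symb} (hx : PolyTime A x) :
    PolyTime A fun c => DefaultLogic.parseParts (x c) := by
  have hfold := foldl_of_growth (h := fun _ s a => DefaultLogic.parseStep s a)
    (g := fun _ => ([], true, [], [], [], [])) hx (const _) (parseStep id.snd.fst id.snd.snd) 10
    fun c a _ s => by simpa only [eval_ofNat] using size_parseStep_le s a
  exact hfold.snd.snd.snd.snd.snd

theorem size_tripleStep_le {α : Type} [Coded α] (s : List α × List (α × α × α)) (a : α) :
    size (tripleStep s a) ≤ size s + (size a + 10) := by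
  obtain ⟨_ | ⟨x, _ | ⟨y, s⟩⟩, t⟩ := s <;> simp [tripleStep] <;> omega

theorem triples {α : Type} [Coded α] {f : γ → List α} (hf : PolyTime A f) :
    PolyTime A fun c => DefaultLogic.triples (f c) := by
  obtain ⟨P, hP⟩ := hf.exists_size_le
  have hstep : PolyTime A fun x : γ × (List α × List (α × α × α)) × α => tripleStep x.2.1 x.2.2 :=
    ite id.snd.fst.fst.tail.isEmpty ((id.snd.snd.cons id.snd.fst.fst).pair id.snd.fst.snd)
      ((const []).pair (((id.snd.fst.fst.tail.headD id.snd.snd).pair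
        ((id.snd.fst.fst.headD id.snd.snd).pair id.snd.snd)).cons id.snd.fst.snd))
  have hfold := foldl_of_growth (h := fun _ s a => tripleStep s a) (g := fun _ => ([], [])) hf
    (const _) hstep (P + 10) fun c a ha s => by
      have helem := size_le_of_mem ha
      have hlist := hP c
      have hgrowth := size_tripleStep_le s a
      simp only [eval_add, eval_ofNat]
      omega
  exact hfold.snd.reverse

theorem parse {x : γ → List Symb} (hx : PolyTime A x) :
    PolyTime A fun c => DefaultLogic.parse (x c) := by
  have hparts := hx.parseParts
  have hmk : PolyTime A fun J : List RawCNF × List RawDefault × List Var =>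
      RawInstance.mk J.1 J.2.1 J.2.2 := of_toData fun _ => rfl
  exact hmk.comp <| (hparts.tail.tail.headD (const ([], []))).fst.pair <|
    (hparts.tail.headD (const ([], []))).fst.triples.pair <|
      map (g := fun _ l => Literal.var l) (hparts.headD (const ([], []))).snd id.snd.var

end Parsing

section Encoding

theorem encodeListWith {α : Type} [Coded α] {f : γ → List α} {t : Symb} {h : α → List Symb}
    (hf : PolyTime A f) (hh : PolyTime A h) :
    PolyTime A fun c => DefaultLogic.encodeListWith t h (f c) :=
  (flatMap (g := fun _ a => h a) hf (hh.comp id.snd)).append (const [t])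

theorem encodeVar : PolyTime A DefaultLogic.encodeVar := by
  have hbit : PolyTime A Symb.bit := by
    convert ite id (const (Symb.bit true)) (const (Symb.bit false)) using 2 with b
    cases b <;> rfl
  exact encodeListWith (h := fun b => [Symb.bit b]) id (hbit.cons (const []))

theorem encodeLiteral : PolyTime A DefaultLogic.encodeLiteral := by
  convert ((isPos id).ite (const Symb.pos) (const Symb.neg)).cons (encodeVar.comp (var id))
    using 2 with l
  cases l <;> rfl

theorem encodeCNF : PolyTime A DefaultLogic.encodeCNF :=
  encodeListWith id (encodeListWith id encodeLiteral)

theorem encodeDefault : PolyTime A DefaultLogic.encodeDefault :=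
  ((encodeCNF.comp id.fst).append (encodeCNF.comp id.snd.fst)).append (encodeCNF.comp id.snd.snd)

theorem encode {I : γ → RawInstance} (hI : PolyTime A I) : PolyTime A fun c => (I c).encode :=
  (encodeListWith hI.kb encodeCNF).append <|
    (encodeListWith hI.rules encodeDefault).append (encodeListWith hI.backdoor encodeVar)

end Encoding

section Search

theorem size_sublistsUpTo_le {α ν : Type} [Coded α] (n : List ν) (l : List α) :
    size (DefaultLogic.sublistsUpTo n l) ≤ (n.length + 1) * (size l + 1) + 1 := by
  have hsize : ∀ m ∈ DefaultLogic.sublistsUpTo n l, size m ≤ size l := fun m hm =>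
    size_le_of_sublist (sublist_of_mem_sublistsUpTo hm)
  refine (size_le_of_forall hsize).trans ?_
  gcongr
  exact length_sublistsUpTo_le n l

theorem sublistsUpTo {α ν : Type} [Coded α] [Coded ν] {n : γ → List ν} {l : γ → List α}
    (hn : PolyTime A n) (hl : PolyTime A l) :
    PolyTime A fun c => DefaultLogic.sublistsUpTo (n c) (l c) := by
  obtain ⟨N, hN⟩ := hn.exists_size_le
  obtain ⟨P, hP⟩ := hl.exists_size_le
  have hstep : PolyTime A fun x : γ × List (List α) × α =>
      (x.2.1 ++ x.2.1.map (x.2.2 :: ·)).take (n x.1).length :=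
    take_length hn.comp_fst (id.snd.fst.append
      (map (g := fun x s => x.2.2 :: s) id.snd.fst (id.fst.snd.snd.cons id.snd)))
  refine foldl (h := fun c s a => (s ++ s.map (a :: ·)).take (n c).length) (g := fun _ => [[]])
    hl.reverse (const _) hstep ((N + 1) * (P + 1) + 1) fun c m hm => ?_
  have hstate : m.foldl (fun s a => (s ++ s.map (a :: ·)).take (n c).length) [[]] =
      DefaultLogic.sublistsUpTo (n c) m.reverse := by
    rw [DefaultLogic.sublistsUpTo, List.reverse_reverse]
  have hlength : (n c).length ≤ N.eval (size c) := (length_lt_size _).le.trans (hN c)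
  have hsize : size m.reverse ≤ P.eval (size c) := by
    rw [size_reverse]
    exact (size_le_of_sublist hm.sublist).trans ((size_reverse _).trans_le (hP c))
  rw [hstate]
  refine (size_sublistsUpTo_le _ _).trans ?_
  simp only [eval_add, eval_mul, eval_one]
  gcongr

theorem dedup {l : γ → List Var} (hl : PolyTime A l) : PolyTime A fun c => (l c).dedup := by
  obtain ⟨P, hP⟩ := hl.reverse.exists_size_le
  have hfold := foldl_of_growth (h := fun _ s a => if decide (a ∈ s) = true then s else a :: s)
    (g := fun _ => []) hl.reverse (const _) ((var_mem id.snd.snd id.snd.fst).ite id.snd.fst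
      (id.snd.snd.cons id.snd.fst)) (P + 1) fun c a ha s => by
        have helem := size_le_of_mem ha
        have hlist := hP c
        simp only [eval_add, eval_one]
        split_ifs
        · omega
        · rw [size_cons]; omega
  convert hfold using 2 with c
  rw [List.foldl_reverse]
  induction l c with
  | nil => rfl
  | cons a l ih =>
    rw [List.foldr_cons, ← ih, List.dedup_cons]
    by_cases ha : a ∈ l <;> simp [ha]

variable {I : γ → RawInstance} {B : γ → List Var}

theorem clauses (hI : PolyTime A I) : PolyTime A fun c => (I c).clauses :=
  (hI.kb.append (flatMap (g := fun _ (d : RawDefault) => [d.1, d.2.1, d.2.2]) hI.rules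
    (id.snd.fst.cons (id.snd.snd.fst.cons (id.snd.snd.snd.cons (const [])))))).flatten

theorem containsVars (hI : PolyTime A I) (hB : PolyTime A B) :
    PolyTime A fun c => (I c).containsVars (B c) :=
  all (p := fun c x => (I c).clauses.any fun C => C.any fun l => decide (l.var = x)) hB <|
    any (p := fun (x : γ × Var) C => C.any fun l => decide (l.var = x.2)) hI.clauses.comp_fst <|
      any (p := fun (x : (γ × Var) × List (Literal Var)) (l : Literal Var) =>
        decide (l.var = x.1.2)) id.snd (var_eq id.snd.var id.fst.fst.snd)

theorem isPositiveUnitOutside (hI : PolyTime A I) (hB : PolyTime A B) :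
    PolyTime A fun c => (I c).isPositiveUnitOutside (B c) :=
  all (p := fun c (C : List (Literal Var)) => C.all fun l => decide (l.var ∈ B c) ||
    (l.isPos && C.all fun l' => decide (l'.var ∈ B c) || decide (l' = l))) hI.clauses <|
  all (p := fun (x : γ × List (Literal Var)) (l : Literal Var) => decide (l.var ∈ B x.1) ||
    (l.isPos && x.2.all fun l' => decide (l'.var ∈ B x.1) || decide (l' = l))) id.snd <|
  (var_mem id.snd.var hB.comp_fst.comp_fst).or <| id.snd.isPos.and <|
  all (p := fun (x : (γ × List (Literal Var)) × Literal Var) (l' : Literal Var) =>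
    decide (l'.var ∈ B x.1.1) || decide (l' = x.2)) id.fst.snd <|
  (var_mem id.snd.var hB.comp_fst.comp_fst.comp_fst).or (literal_eq id.snd id.fst.snd)

theorem sameLength {α β : Type} [Coded α] [Coded β] {l : γ → List α} {m : γ → List β}
    (hl : PolyTime A l) (hm : PolyTime A m) :
    PolyTime A fun c => DefaultLogic.sameLength (l c) (m c) :=
  list_eq unit_eq (map (g := fun _ _ => ()) hl (const ())) (map (g := fun _ _ => ()) hm (const ()))

variable {test : List (List Var) → Bool}

theorem search {ν : Type} [Coded ν] {n : γ → List ν} (ht : PolyTime A test) (hn : PolyTime A n)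
    (hI : PolyTime A I) (hB : PolyTime A B) :
    PolyTime A fun c => (I c).search test (n c) (B c) :=
  any (p := fun c M => (I c).accepts (B c) (DefaultLogic.sublistsUpTo (n c) (B c)) M && test M)
    (hn.sublistsUpTo (hn.sublistsUpTo hB)) <|
    (accepts hI.comp_fst hB.comp_fst (hn.sublistsUpTo hB).comp_fst id.snd).and (ht.comp id.snd)

theorem isYesInstance {y : γ → List (Fin 2)} (ht : PolyTime A test) (hy : PolyTime A y)
    (hI : PolyTime A I) (hB : PolyTime A B) :
    PolyTime A fun c => (I c).isYesInstance test (y c) (B c) :=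
  (hI.containsVars hB).and <| (hI.isPositiveUnitOutside hB).and <|
    (hB.sameLength (filter (p := fun _ i => decide (i = 0)) hy (fintype_eq id.snd (const 0)))).and
      (search ht hy hI hB)

theorem decision {x : γ → List Symb} {y : γ → List (Fin 2)} (ht : PolyTime A test)
    (hx : PolyTime A x) (hy : PolyTime A y) :
    PolyTime A fun c => DefaultLogic.decision test (x c) (y c) :=
  (list_eq symb_eq hx.parse.encode hx).and
    (isYesInstance ht hy hx.parse hx.parse.backdoor.dedup)

end Search

end StackProgram.PolyTime

/-! ### Fixed-parameter tractability -/

namespace DefaultLogic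

open StackProgram Computability

theorem computable_paddedParameter : Computable paddedParameter := by
  have hpow : Primrec fun k : ℕ => 2 ^ k :=
    (Primrec.nat_rec₁ 1 (Primrec.nat_double.comp Primrec.snd).to₂).of_eq fun k => by
      induction k with
      | zero => rfl
      | succ k ih => rw [pow_succ', ← ih]
  have hreplicate : ∀ (i : Fin 2) {f : ℕ → ℕ}, Primrec f →
      Primrec fun k => List.replicate (f k) i := fun i f hf =>
    (Primrec.list_map (Primrec.list_range.comp hf) (Primrec.const i).to₂).of_eq fun k => by
      rw [List.map_const', List.length_range]
  exact (Primrec.list_append.comp (hreplicate 0 Primrec.id)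
    (hreplicate 1 (hpow.comp hpow))).to_comp

section Words

variable {α β : Type} (x : List α) (y : List β)

/-- The letters of the first alphabet in a word over the sum of two alphabets. -/
def leftPart (z : List (α ⊕ β)) : List α := z.flatMap (Sum.elim (fun a => [a]) fun _ => [])

/-- The letters of the second alphabet in a word over the sum of two alphabets. -/
def rightPart (z : List (α ⊕ β)) : List β := z.flatMap (Sum.elim (fun _ => []) fun b => [b])

theorem leftPart_map_append_map : leftPart (x.map Sum.inl ++ y.map Sum.inr) = x := by
  simp [leftPart, List.flatMap_map]

theorem rightPart_map_append_map : rightPart (x.map Sum.inl ++ y.map Sum.inr) = y := by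
  simp [rightPart, List.flatMap_map]

end Words

theorem encodingProd_encodingList_encode {α β : Type} (x : List α) (y : List β) :
    (encodingProd (encodingList α) (encodingList β)).encode (x, y) =
      x.map Sum.inl ++ y.map Sum.inr := rfl

theorem polyTime_letter {A β : Type} [Coded β] (g : Symb ⊕ Fin 2 → β) :
    PolyTime A fun x : List (Symb ⊕ Fin 2) × (Symb ⊕ Fin 2) => g x.2 :=
  have : Nonempty (Symb ⊕ Fin 2) := ⟨.inr 0⟩
  PolyTime.fintype_cases (f := fun _ a => g a) PolyTime.id.snd fun a => PolyTime.const (g a)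

theorem inP_decision {test : List (List Var) → Bool} (ht : PolyTime (Symb ⊕ Fin 2) test) :
    InP (encodingProd (encodingList Symb) (encodingList (Fin 2)))
      {p | decision test p.1 p.2 = true} := by
  have : Inhabited (Symb ⊕ Fin 2) := ⟨.inr 0⟩
  have hleft : PolyTime (Symb ⊕ Fin 2) (leftPart (α := Symb) (β := Fin 2)) :=
    PolyTime.flatMap PolyTime.id (polyTime_letter _)
  have hright : PolyTime (Symb ⊕ Fin 2) (rightPart (α := Symb) (β := Fin 2)) :=
    PolyTime.flatMap PolyTime.id (polyTime_letter _)
  refine (PolyTime.decision ht hleft hright).inP fun ⟨x, y⟩ => ?_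
  rw [encodingProd_encodingList_encode, leftPart_map_append_map, rightPart_map_append_map,
    Set.mem_ofPred_eq]

theorem IsWitnessedBy.inFPT {Q : DefaultTheory Var → Prop} {test : List (List Var) → Bool}
    (h : IsWitnessedBy Q test) (ht : PolyTime (Symb ⊕ Fin 2) test) :
    InFPT (backdoorEvaluation Q classCNF classID) :=
  ⟨2, paddedParameter, _, computable_paddedParameter, inP_decision ht,
    h.mem_backdoorEvaluation_iff⟩

end DefaultLogic

theorem mainTheorem6 :
    DefaultLogic.InFPT (DefaultLogic.SBDexpl DefaultLogic.classCNF DefaultLogic.classID) ∧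
      DefaultLogic.InFPT
        (DefaultLogic.consistentSBDexpl DefaultLogic.classCNF DefaultLogic.classID) :=
  ⟨DefaultLogic.isWitnessedBy_hasStableExtension.inFPT (StackProgram.PolyTime.const true),
    DefaultLogic.isWitnessedBy_hasConsistentStableExtension.inFPT
      StackProgram.PolyTime.id.isEmpty.not⟩
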